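/- Fix an integer $\Delta\ge 2$ and a finite connected $\Delta$-regular graph $H$ with $v_H$ vertices and $e(H)$ edges. For a graph $G$ on $\{1,\dots,n\}$ (a subgraph of $K_n$) let $e(G)$ be its number of edges, let $N(H,G)$ be the number of labelled copies of $H$ in $G$ (injective maps $V(H)\to V(G)$ sending edges of $H$ to edges of $G$), and for $e\in E(G)$ let $N(H,G,e)$ be the number of labelled copies of $H$ in $G$ that contain the edge $e$. Given $\delta,\varepsilon,\bar C_\star>0$ and $p\in(0,1)$, call $G\subset K_n$ a \emph{strong-core graph} if 1. $N(H,G)\ge \delta(1-6\varepsilon)\,n^{v_H}p^{e(H)}$, 2. $e(G)\le \bar C_\star n^2p^\Delta$, and 3. $N(H,G,e)\ge (\delta\varepsilon/\bar C_\star)\,(np^{\Delta/2})^{v_H-2}$ for every $e\in E(G)$. Then there are a nonnegative function $\mathfrak f_H$ with $\lim_{\varepsilon\downarrow 0}\mathfrak f_H(\varepsilon)=0$ and an $\varepsilon_0>0$ such that for every $\delta>0$, every constant $\bar C_\star\in(0,\infty)$, every $0<\varepsilon<\varepsilon_0$ and every sequence $p=p_n\in(0,1)$ with $np^{\Delta/2}\to\infty$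 and $np^{\Delta/2}\le n^{1/2}$ for all large $n$, $$\liminf_{n\to\infty}\,-\frac{\log \mathbb P\big(\exists\, G\subset \mathbb G(n,p):\ G\text{ is a strong-core graph}\big)}{n^2p^\Delta\log(1/p)}\ \ge\ \tfrac12\,\delta^{2/v_H}\,\big(1-\mathfrak f_H(\varepsilon)\big),$$ where $\mathbb G(n,p)$ is the Erdős–Rényi random graph on $n$ vertices and $-\log 0=+\infty$. -/

import Mathlib

/-- `N(H, G, e)`: the number of labelled copies of `H` in `G` (injective graph homomorphisms
`φ : H → G`) that contain the edge `e`, i.e. for which `e` is the image under `φ` of an edge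
of `H`. The number `N(H, G)` of all labelled copies is Mathlib's `G.labelledCopyCount H`. -/
noncomputable def labelledCopyCountThrough {V W : Type*} (G : SimpleGraph W) (H : SimpleGraph V)
    (e : Sym2 W) : ℕ :=
  Nat.card {φ : SimpleGraph.Copy H G // ∃ e' ∈ H.edgeSet, Sym2.map φ e' = e}

/-- `G ⊆ K_n` is a strong-core graph for the `Δ`-regular graph `H`, with parameters `δ`, `ε`,
edge probability `p`, and constant `C`. (Since `H` will be `Δ`-regular with `Δ ≥ 2`, it has at
least three vertices, so the natural subtraction `v_H - 2` is not truncated.) -/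
structure IsStrongCore {V : Type*} [Fintype V] (H : SimpleGraph V) (Δ : ℕ) (δ ε C : ℝ)
    (n : ℕ) (p : ℝ) (G : SimpleGraph (Fin n)) : Prop where
  copies : δ * (1 - 6 * ε) * (n : ℝ) ^ Fintype.card V * p ^ H.edgeSet.ncard
    ≤ (G.labelledCopyCount H : ℝ)
  edges : (G.edgeSet.ncard : ℝ) ≤ C * (n : ℝ) ^ 2 * p ^ Δ
  copies_through : ∀ e ∈ G.edgeSet,
    δ * ε / C * ((n : ℝ) * p ^ ((Δ : ℝ) / 2)) ^ (Fintype.card V - 2)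
      ≤ (labelledCopyCountThrough G H e : ℝ)

/-- The probability that the binomial random graph `G(n, p)` contains, as a subgraph, a
strong-core graph. -/
noncomputable def strongCoreProb {V : Type*} [Fintype V] (H : SimpleGraph V) (Δ : ℕ)
    (δ ε C : ℝ) (n : ℕ) (p : unitInterval) : ENNReal :=
  SimpleGraph.binomialRandom (Fin n) p
    {G' | ∃ G : SimpleGraph (Fin n), G ≤ G' ∧ IsStrongCore H Δ δ ε C n (p : ℝ) G}

/-! Write x = n p^{Δ/2}, q = p^{Δ/2} and v = v_H. The starting point is the union bound ∑ p^{e(G)}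
over strong-core graphs G, in which factors exp(o(x² log(1/p))) are harmless. Shearer's inequality
gives N(H,G) ≤ (2e(G))^{v/2}, hence the right lower bound on e(G). This alone is not enough: G may
have order x² vertices of bounded degree, and choosing them can cost exp of order x² log n,
comparable to the main term.

The remedy is to let each low vertex pay for itself. Let L be the set of vertices of positive degree
at most a constant D. The key inequality is N(H,G) ≤ (2e(G) − Δ|L|)^{v/2} + κx^v with κ small. So
2e(G) − Δ|L| is at least about δ^{2/v}x², and p^{e(G)} is at most about p^{δ^{2/v}x²/2} q^{|L|}.
Summing q^{|L|} over all L gives (1+q)^n ≤ e^x, which is negligible (`sum_pow_card_lowVerts_le`).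
For fixed L there are only n^R exp(O(x²)) graphs, with R a small multiple of x² (`card_graphs_le`).

Both ingredients rest on `exists_le_degree_mul_degree`: many copies through every edge force
d(u)d(v) ≥ cx² along edges. Hence L is independent and has boundedly many neighbours. Moreover the
rank of v by decreasing degree is O(d(u)), so once the high vertices are ordered, the edges cost O(∑
d(u)) bits.

For the key inequality, let W be the set of high vertices. By connectedness a copy lies in W,
alternates between L and its neighbourhood, or uses an edge between that neighbourhood and W.
Choosing D among boundedly many scales by pigeonhole makes the last kind rare. For the alternating
kind, injectivity around each low vertex yields the discount Δ per vertex
(`two_mul_card_bipartite_copyMaps_le`). -/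

/-! ### Hölder and Shearer inequalities -/

/-- **Hölder's inequality** for the geometric mean of finitely many finite sequences. -/
theorem sum_prod_rpow_inv_card_le {ι α : Type*} (J : Finset ι) (A : Finset α) (f : ι → α → ℝ)
    (hf : ∀ j ∈ J, ∀ x ∈ A, 0 ≤ f j x) (hJ : J.Nonempty) :
    ∑ x ∈ A, ∏ j ∈ J, f j x ^ ((J.card : ℝ)⁻¹) ≤ ∏ j ∈ J, (∑ x ∈ A, f j x) ^ ((J.card : ℝ)⁻¹) := by
  have hk : (0 : ℝ) < J.card := by exact_mod_cast hJ.card_pos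
  by_cases h0 : ∃ j ∈ J, ∑ x ∈ A, f j x = 0
  · obtain ⟨j, hj, hs⟩ := h0
    rw [Finset.sum_eq_zero_iff_of_nonneg (hf j hj)] at hs
    refine le_trans (le_of_eq (Finset.sum_eq_zero fun x hx => Finset.prod_eq_zero hj ?_)) ?_
    · rw [hs x hx, Real.zero_rpow (by positivity)]
    · exact Finset.prod_nonneg fun j hj => Real.rpow_nonneg (Finset.sum_nonneg (hf j hj)) _
  · push Not at h0
    have hpos : ∀ j ∈ J, 0 < ∑ x ∈ A, f j x := fun j hj =>
      lt_of_le_of_ne (Finset.sum_nonneg (hf j hj)) (Ne.symm (h0 j hj))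
    have hP : 0 < ∏ j ∈ J, (∑ x ∈ A, f j x) ^ ((J.card : ℝ)⁻¹) :=
      Finset.prod_pos fun j hj => Real.rpow_pos_of_pos (hpos j hj) _
    -- With each `f j` normalised to total 1, the claim is pointwise AM-GM summed over `x`.
    rw [← div_le_one hP, Finset.sum_div]
    calc ∑ x ∈ A, (∏ j ∈ J, f j x ^ ((J.card : ℝ)⁻¹)) /
          ∏ j ∈ J, (∑ x ∈ A, f j x) ^ ((J.card : ℝ)⁻¹)
        ≤ ∑ x ∈ A, ∑ j ∈ J, (J.card : ℝ)⁻¹ * (f j x / ∑ x ∈ A, f j x) := by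
          refine Finset.sum_le_sum fun x hx => ?_
          rw [← Finset.prod_div_distrib]
          refine le_trans (le_of_eq (Finset.prod_congr rfl fun j hj => ?_))
            (Real.geom_mean_le_arith_mean_weighted J (fun _ => (J.card : ℝ)⁻¹)
              (fun j => f j x / ∑ x ∈ A, f j x) (fun _ _ => by positivity) ?_ ?_)
          · rw [Real.div_rpow (hf j hj x hx) (hpos j hj).le]
          · rw [Finset.sum_const, nsmul_eq_mul, mul_inv_cancel₀ hk.ne']
          · exact fun j hj => div_nonneg (hf j hj x hx) (hpos j hj).le
      _ = ∑ j ∈ J, (J.card : ℝ)⁻¹ * ((∑ x ∈ A, f j x) / ∑ x ∈ A, f j x) := by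
          rw [Finset.sum_comm]
          simp only [Finset.sum_div, Finset.mul_sum]
      _ = ∑ j ∈ J, (J.card : ℝ)⁻¹ :=
          Finset.sum_congr rfl fun j hj => by rw [div_self (h0 j hj), mul_one]
      _ ≤ 1 := by rw [Finset.sum_const, nsmul_eq_mul, mul_inv_cancel₀ hk.ne']

open Classical in
/-- The number of restrictions to `s` of the functions in the family `F`. -/
noncomputable def traceCard {V X : Type*} (F : Finset (V → X)) (s : Finset V) : ℕ :=
  (F.image s.restrict).card

-- A restriction to `insert i s` is a value at `i` together with a restriction to `s`. This replaces
-- the chain rule for entropy in the proof of Shearer's inequality.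
open Classical in
theorem traceCard_insert {V X : Type*} [Fintype X] (F : Finset (V → X)) {s : Finset V} {i : V}
    (hi : i ∉ s) :
    traceCard F (insert i s) = ∑ x, traceCard {φ ∈ F | φ i = x} s := by
  have hm : i ∈ insert i s := Finset.mem_insert_self i s
  unfold traceCard
  rw [Finset.card_eq_sum_card_fiberwise (f := fun g : ↥(insert i s) → X => g ⟨i, hm⟩)
    (t := Finset.univ) (fun _ _ => Finset.mem_coe.2 (Finset.mem_univ _))]
  refine Finset.sum_congr rfl fun x _ => ?_
  rw [← Finset.card_image_of_injOn
    (f := Finset.restrict₂ (π := fun _ => X) (Finset.subset_insert i s))]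
  · congr 1
    ext g
    simp only [Finset.mem_image, Finset.mem_filter]
    constructor
    · rintro ⟨_, ⟨⟨φ, hφ, rfl⟩, hx⟩, rfl⟩
      exact ⟨φ, ⟨hφ, hx⟩, rfl⟩
    · rintro ⟨φ, ⟨hφ, hx⟩, rfl⟩
      exact ⟨_, ⟨⟨φ, hφ, rfl⟩, hx⟩, rfl⟩
  · intro g hg g' hg' h
    simp only [Finset.coe_filter, Set.mem_ofPred_eq] at hg hg'
    ext ⟨j, hj⟩
    rcases Finset.mem_insert.1 hj with rfl | hjs
    · exact hg.2.trans hg'.2.symm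
    · exact congrFun h ⟨j, hjs⟩

open Classical in
theorem traceCard_mono {V X : Type*} {F F' : Finset (V → X)} (h : F ⊆ F') (s : Finset V) :
    traceCard F s ≤ traceCard F' s :=
  Finset.card_le_card (Finset.image_subset_image h)

open Classical in
/-- **Shearer's inequality**, in its combinatorial form: if every element of `s` lies in exactly `k`
of the sets `B j`, the size of a trace on `s` is bounded by the traces on the sets `B j`. -/
theorem traceCard_le_prod_traceCard_rpow {V X J : Type*} [Fintype X] [Fintype J]
    (B : J → Finset V) {k : ℕ} (hk : 0 < k) (s : Finset V)
    (hB : ∀ i ∈ s, (Finset.univ.filter fun j => i ∈ B j).card = k) (F : Finset (V → X)) :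
    (traceCard F s : ℝ) ≤ ∏ j, (traceCard F (B j ∩ s) : ℝ) ^ ((k : ℝ)⁻¹) := by
  have hkr : (0 : ℝ) < k := by exact_mod_cast hk
  induction s using Finset.induction_on generalizing F with
  | empty =>
    rcases F.eq_empty_or_nonempty with rfl | hF
    · simp only [traceCard, Finset.image_empty, Finset.card_empty, Nat.cast_zero]
      positivity
    · have h1 : traceCard F ∅ = 1 := by
        refine le_antisymm ?_ (Finset.card_pos.2 (hF.image _))
        exact Finset.card_le_one.2 fun a _ b _ => Subsingleton.elim a b
      simp [h1]
  | insert i s hi ih =>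
    have hB' : ∀ i ∈ s, (Finset.univ.filter fun j => i ∈ B j).card = k :=
      fun j hj => hB j (Finset.mem_insert_of_mem hj)
    set I : Finset J := Finset.univ.filter fun j => i ∈ B j with hI
    have hIc : I.card = k := hB i (Finset.mem_insert_self i s)
    have hIn : I.Nonempty := Finset.card_pos.1 (hIc ▸ hk)
    have hin : ∀ j ∈ I, traceCard F (B j ∩ insert i s) =
        ∑ x, traceCard {φ ∈ F | φ i = x} (B j ∩ s) := by
      intro j hj
      rw [Finset.inter_insert_of_mem (Finset.mem_filter.1 hj).2]
      exact traceCard_insert F fun h => hi (Finset.mem_inter.1 h).2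
    have hout : ∀ j ∈ Finset.univ.filter (fun j => ¬ i ∈ B j), ∀ x,
        traceCard {φ ∈ F | φ i = x} (B j ∩ s) ≤ traceCard F (B j ∩ insert i s) := by
      intro j hj x
      rw [Finset.inter_insert_of_notMem (Finset.mem_filter.1 hj).2]
      exact traceCard_mono (Finset.filter_subset _ _) _
    rw [traceCard_insert F hi, Nat.cast_sum,
      ← Finset.prod_filter_mul_prod_filter_not Finset.univ (fun j => i ∈ B j)]
    -- Condition on the value at `i`. For sets avoiding `i` the fibre is enlarged to all of `F`;
    -- over the `k` sets containing `i`, Hölder sums the fibres back to full traces.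
    calc ∑ x, (traceCard {φ ∈ F | φ i = x} s : ℝ)
        ≤ ∑ x, (∏ j ∈ I, (traceCard {φ ∈ F | φ i = x} (B j ∩ s) : ℝ) ^ ((k : ℝ)⁻¹)) *
            ∏ j ∈ Finset.univ.filter (fun j => ¬ i ∈ B j),
              (traceCard F (B j ∩ insert i s) : ℝ) ^ ((k : ℝ)⁻¹) := by
          refine Finset.sum_le_sum fun x _ => (ih hB' _).trans ?_
          rw [← Finset.prod_filter_mul_prod_filter_not Finset.univ (fun j => i ∈ B j)]
          refine mul_le_mul_of_nonneg_left (Finset.prod_le_prod (fun _ _ => by positivity)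
            fun j hj => ?_) (by positivity)
          exact Real.rpow_le_rpow (by positivity) (by exact_mod_cast hout j hj x) (by positivity)
      _ ≤ _ := by
          rw [← Finset.sum_mul]
          refine mul_le_mul_of_nonneg_right ?_ (by positivity)
          have := sum_prod_rpow_inv_card_le I Finset.univ
            (fun j x => (traceCard {φ ∈ F | φ i = x} (B j ∩ s) : ℝ)) (fun _ _ _ _ => by positivity)
            hIn
          rw [hIc] at this
          refine this.trans (le_of_eq (Finset.prod_congr rfl fun j hj => ?_))
          rw [hin j hj, Nat.cast_sum]

open Classical in
theorem traceCard_univ {V X : Type*} [Fintype V] (F : Finset (V → X)) :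
    traceCard F Finset.univ = F.card := by
  refine Finset.card_image_of_injective _ fun φ ψ h => funext fun a => ?_
  exact congrFun h ⟨a, Finset.mem_univ a⟩

open Classical in
theorem traceCard_pair_le {V X : Type*} (F : Finset (V → X)) (a b : V) :
    traceCard F {a, b} ≤ (F.image fun φ => (φ a, φ b)).card := by
  have ha : a ∈ ({a, b} : Finset V) := by simp
  have hb : b ∈ ({a, b} : Finset V) := by simp
  refine Finset.card_le_card_of_injOn (fun g => (g ⟨a, ha⟩, g ⟨b, hb⟩)) ?_ ?_
  · intro g hg
    obtain ⟨φ, hφ, rfl⟩ := Finset.mem_image.1 hg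
    exact Finset.mem_coe.2 (Finset.mem_image.2 ⟨φ, hφ, rfl⟩)
  · intro g _ g' _ h
    rw [Prod.mk.injEq] at h
    ext ⟨j, hj⟩
    rcases Finset.mem_insert.1 hj with rfl | hj'
    · exact h.1
    · rw [Finset.mem_singleton] at hj'
      subst hj'
      exact h.2

open Classical in
theorem card_darts_snd {V : Type*} [Fintype V] (H : SimpleGraph V) (a : V) :
    (Finset.univ.filter fun d : H.Dart => d.snd = a).card = H.degree a := by
  rw [← H.dart_fst_fiber_card_eq_degree a]
  refine Finset.card_bij (fun d _ => d.symm) ?_ ?_ ?_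
  · intro d hd
    simpa using hd
  · intro d _ d' _ h
    exact SimpleGraph.Dart.symm_involutive.injective h
  · intro d hd
    exact ⟨d.symm, by simpa using hd, SimpleGraph.Dart.symm_symm d⟩

-- Each edge at `a` counts in both orientations, so in a Δ-regular graph the darts cover every
-- vertex 2Δ times. This is the cover fed to Shearer's inequality.
open Classical in
theorem card_darts_mem {V : Type*} [Fintype V] (H : SimpleGraph V) (a : V) :
    (Finset.univ.filter fun d : H.Dart => a ∈ ({d.fst, d.snd} : Finset V)).card
      = 2 * H.degree a := by
  have h : (Finset.univ.filter fun d : H.Dart => a ∈ ({d.fst, d.snd} : Finset V)) =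
      (Finset.univ.filter fun d : H.Dart => d.fst = a) ∪
        (Finset.univ.filter fun d : H.Dart => d.snd = a) := by
    ext d
    simp [eq_comm]
  rw [h, Finset.card_union_of_disjoint, card_darts_snd, H.dart_fst_fiber_card_eq_degree, two_mul]
  rw [Finset.disjoint_filter]
  rintro d _ rfl h2
  exact d.adj.ne h2.symm

open Classical in
/-- Shearer's inequality for a family of maps from a regular graph, in terms of the pairs that
occur along each dart. -/
theorem card_pow_le_prod_darts {V X : Type*} [Fintype V] [Fintype X] (H : SimpleGraph V) {Δ : ℕ}
    (hΔ : 0 < Δ) (hreg : ∀ a, H.degree a = Δ) (F : Finset (V → X)) (b : H.Dart → ℝ)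
    (hb : ∀ d, ((F.image fun φ => (φ d.fst, φ d.snd)).card : ℝ) ≤ b d) :
    (F.card : ℝ) ^ (2 * Δ) ≤ ∏ d, b d := by
  have hb0 : ∀ d, 0 ≤ b d := fun d => (Nat.cast_nonneg _).trans (hb d)
  have h := traceCard_le_prod_traceCard_rpow (fun d : H.Dart => ({d.fst, d.snd} : Finset V))
    (k := 2 * Δ) (by omega) Finset.univ (fun i _ => by rw [card_darts_mem, hreg]) F
  rw [traceCard_univ] at h
  have h2 : (F.card : ℝ) ≤ ∏ d, b d ^ (((2 * Δ : ℕ) : ℝ)⁻¹) := by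
    refine h.trans (Finset.prod_le_prod (fun _ _ => by positivity) fun d _ => ?_)
    refine Real.rpow_le_rpow (by positivity) ?_ (by positivity)
    rw [Finset.inter_univ]
    exact le_trans (by exact_mod_cast traceCard_pair_le F d.fst d.snd) (hb d)
  calc (F.card : ℝ) ^ (2 * Δ) ≤ (∏ d, b d ^ (((2 * Δ : ℕ) : ℝ)⁻¹)) ^ (2 * Δ) := by gcongr
    _ = ∏ d, b d := by
      rw [← Finset.prod_pow]
      exact Finset.prod_congr rfl fun d _ => Real.rpow_inv_natCast_pow (hb0 d) (by omega)

/-! ### Labelled copies as finite families of maps -/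

open Classical in
/-- The labelled copies of `H` in `G`, as a finite set of maps. -/
noncomputable def copyMaps {V X : Type*} [Fintype V] [Fintype X] (H : SimpleGraph V)
    (G : SimpleGraph X) : Finset (V → X) :=
  Finset.univ.filter fun φ => Function.Injective φ ∧ ∀ a b, H.Adj a b → G.Adj (φ a) (φ b)

theorem mem_copyMaps {V X : Type*} [Fintype V] [Fintype X] {H : SimpleGraph V}
    {G : SimpleGraph X} {φ : V → X} :
    φ ∈ copyMaps H G ↔ Function.Injective φ ∧ ∀ a b, H.Adj a b → G.Adj (φ a) (φ b) := by
  simp [copyMaps]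

theorem coe_mem_copyMaps {V X : Type*} [Fintype V] [Fintype X] {H : SimpleGraph V}
    {G : SimpleGraph X} (φ : SimpleGraph.Copy H G) : ⇑φ ∈ copyMaps H G :=
  mem_copyMaps.2 ⟨φ.injective, fun _ _ h => φ.toHom.map_adj h⟩

theorem labelledCopyCount_le_card_copyMaps {V X : Type*} [Fintype V] [Fintype X]
    (H : SimpleGraph V) (G : SimpleGraph X) : G.labelledCopyCount H ≤ (copyMaps H G).card := by
  classical
  unfold SimpleGraph.labelledCopyCount
  rw [← Fintype.card_coe]
  refine Fintype.card_le_of_injective (fun φ => ⟨⇑φ, coe_mem_copyMaps φ⟩) fun φ ψ h => ?_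
  exact DFunLike.coe_injective (Subtype.ext_iff.1 h)

-- A copy through the edge uv sends some dart onto (u, v), reversing the dart if necessary. The
-- count thus reduces to copies with two pinned vertices.
open Classical in
theorem labelledCopyCountThrough_le {V X : Type*} [Fintype V] [Fintype X]
    (H : SimpleGraph V) (G : SimpleGraph X) (u v : X) :
    labelledCopyCountThrough G H s(u, v) ≤
      ∑ d : H.Dart, ((copyMaps H G).filter fun φ => φ d.fst = u ∧ φ d.snd = v).card := by
  unfold labelledCopyCountThrough
  rw [Nat.card_eq_fintype_card]
  refine le_trans ?_ Finset.card_biUnion_le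
  rw [← Fintype.card_coe]
  refine Fintype.card_le_of_injective (fun φ => ⟨⇑φ.1, ?_⟩) fun φ ψ h => ?_
  · obtain ⟨φ, e, he, hφ⟩ := φ
    induction e with
    | _ a b =>
    rw [SimpleGraph.mem_edgeSet] at he
    rw [Sym2.map_mk, Sym2.eq_iff] at hφ
    simp only [Finset.mem_biUnion, Finset.mem_filter, Finset.mem_univ, true_and]
    rcases hφ with h | h
    · exact ⟨⟨(a, b), he⟩, coe_mem_copyMaps φ, h⟩
    · exact ⟨⟨(b, a), he.symm⟩, coe_mem_copyMaps φ, h.symm⟩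
  · exact Subtype.ext (DFunLike.coe_injective (Subtype.ext_iff.1 h))

/-! ### Copies through an edge force large degree products -/

open Classical in
theorem prod_darts_fst {V : Type*} [Fintype V] (H : SimpleGraph V) (a : V) (r : ℝ) :
    ∏ d : H.Dart, (if d.fst = a then r else 1) = r ^ H.degree a := by
  rw [Finset.prod_ite, Finset.prod_const, Finset.prod_const_one, mul_one,
    H.dart_fst_fiber_card_eq_degree]

open Classical in
theorem prod_darts_snd {V : Type*} [Fintype V] (H : SimpleGraph V) (a : V) (r : ℝ) :
    ∏ d : H.Dart, (if d.snd = a then r else 1) = r ^ H.degree a := by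
  rw [Finset.prod_ite, Finset.prod_const, Finset.prod_const_one, mul_one, card_darts_snd]

open Classical in
theorem prod_darts_edge {V : Type*} [Fintype V] (H : SimpleGraph V) {a b : V} (h : H.Adj a b)
    (r : ℝ) : ∏ d : H.Dart, (if d.edge = s(a, b) then r else 1) = r ^ 2 := by
  rw [Finset.prod_ite, Finset.prod_const, Finset.prod_const_one, mul_one,
    H.dart_edge_fiber_card _ h]

open Classical in
theorem card_adj_pairs {X : Type*} [Fintype X] (G : SimpleGraph X) :
    (Finset.univ.filter fun z : X × X => G.Adj z.1 z.2).card = ∑ u, G.degree u := by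
  rw [Finset.card_filter, Fintype.sum_prod_type]
  refine Finset.sum_congr rfl fun u _ => ?_
  rw [← Finset.card_filter, ← G.card_neighborFinset_eq_degree]
  congr 1
  ext v
  simp

open Classical in
/-- The copies of a regular graph that send a given dart to a given dart, in terms of the degrees
of the two end points. -/
theorem card_pinned_copyMaps_pow_le {V X : Type*} [Fintype V] [Fintype X] (H : SimpleGraph V)
    {Δ : ℕ} (hΔ : 0 < Δ) (hreg : ∀ a, H.degree a = Δ) (G : SimpleGraph X) {M : ℝ} (hM0 : 0 < M)
    (hM : ((∑ u, G.degree u : ℕ) : ℝ) ≤ M) (d₀ : H.Dart) {u v : X} (huv : G.Adj u v) :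
    (((copyMaps H G).filter fun φ => φ d₀.fst = u ∧ φ d₀.snd = v).card : ℝ) ^ (2 * Δ)
        * M ^ (4 * Δ - 2) ≤
      M ^ (Fintype.card V * Δ) * ((G.degree u : ℝ) * G.degree v) ^ (2 * Δ - 2) := by
  set a := d₀.fst with ha
  set b := d₀.snd with hb
  have hab : a ≠ b := d₀.adj.ne
  set F := (copyMaps H G).filter fun φ => φ a = u ∧ φ b = v with hF
  have hu : (0 : ℝ) < G.degree u := by
    exact_mod_cast (G.degree_pos_iff_exists_adj u).2 ⟨v, huv⟩
  have hv : (0 : ℝ) < G.degree v := by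
    exact_mod_cast (G.degree_pos_iff_exists_adj v).2 ⟨u, huv.symm⟩
  -- The product encodes the cases: `M` for a free dart, the degree of u or v when one end is
  -- pinned, and 1 when both are. The last factor corrects d(u)d(v)/M to 1 on the pinned edge.
  have key := card_pow_le_prod_darts H hΔ hreg F
    (fun d => M * (if d.fst = a then (G.degree u : ℝ) / M else 1)
      * (if d.snd = a then (G.degree u : ℝ) / M else 1)
      * (if d.fst = b then (G.degree v : ℝ) / M else 1)
      * (if d.snd = b then (G.degree v : ℝ) / M else 1)
      * (if d.edge = s(a, b) then M / (G.degree u * G.degree v) else 1)) ?_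
  · simp only [Finset.prod_mul_distrib, prod_darts_fst, prod_darts_snd, prod_darts_edge H (show H.Adj a b from d₀.adj),
      hreg, Finset.prod_const, Finset.card_univ, H.dart_card_eq_sum_degrees, Finset.sum_const,
      smul_eq_mul] at key
    refine (mul_le_mul_of_nonneg_right key (by positivity)).trans (le_of_eq ?_)
    obtain ⟨k, rfl⟩ : ∃ k, Δ = k + 1 := ⟨Δ - 1, by omega⟩
    have e1 : 4 * (k + 1) - 2 = 4 * k + 2 := by omega
    have e2 : 2 * (k + 1) - 2 = 2 * k := by omega
    rw [e1, e2]
    have c1 : (G.degree u : ℝ) = M * (G.degree u / M) := by field_simp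
    have c2 : (G.degree v : ℝ) = M * (G.degree v / M) := by field_simp
    have c3 : M * (G.degree u / M) * (G.degree v / M) * (M / (G.degree u * G.degree v)) = 1 := by
      field_simp
    generalize M / ((G.degree u : ℝ) * G.degree v) = s at c3 ⊢
    rw [show ((G.degree u : ℝ) * G.degree v) =
      M * (G.degree u / M) * (M * (G.degree v / M)) by rw [← c1, ← c2]]
    generalize (G.degree u : ℝ) / M = r at c3 ⊢
    generalize (G.degree v : ℝ) / M = t at c3 ⊢
    calc _ = M ^ (Fintype.card V * (k + 1)) * (M * r * (M * t)) ^ (2 * k)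
          * (M * r * t * s) ^ 2 := by ring
      _ = _ := by rw [c3, one_pow, mul_one]
  · intro d
    have hmem : ∀ φ ∈ F, φ a = u ∧ φ b = v ∧ G.Adj (φ d.fst) (φ d.snd) := fun φ hφ => by
      obtain ⟨h1, h2, h3⟩ := Finset.mem_filter.1 hφ
      exact ⟨h2, h3, (mem_copyMaps.1 h1).2 _ _ d.adj⟩
    have hfix : ∀ T : Finset (X × X), (∀ φ ∈ F, (φ d.fst, φ d.snd) ∈ T) →
        ((F.image fun φ => (φ d.fst, φ d.snd)).card : ℝ) ≤ T.card := fun T hT => by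
      exact_mod_cast Finset.card_le_card (Finset.image_subset_iff.2 hT)
    have hnb1 : ∀ w, (((G.neighborFinset w).image fun z => (w, z)).card : ℝ) ≤ G.degree w :=
      fun w => by exact_mod_cast Finset.card_image_le
    have hnb2 : ∀ w, (((G.neighborFinset w).image fun z => (z, w)).card : ℝ) ≤ G.degree w :=
      fun w => by exact_mod_cast Finset.card_image_le
    have hfst : ∀ w, (∀ φ ∈ F, φ d.fst = w) →
        ((F.image fun φ => (φ d.fst, φ d.snd)).card : ℝ) ≤ G.degree w := fun w hw => by
      refine (hfix _ fun φ hφ => ?_).trans (hnb1 w)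
      have := (hmem φ hφ).2.2
      rw [hw φ hφ] at this ⊢
      exact Finset.mem_image_of_mem _ ((G.mem_neighborFinset _ _).2 this)
    have hsnd : ∀ w, (∀ φ ∈ F, φ d.snd = w) →
        ((F.image fun φ => (φ d.fst, φ d.snd)).card : ℝ) ≤ G.degree w := fun w hw => by
      refine (hfix _ fun φ hφ => ?_).trans (hnb2 w)
      have := (hmem φ hφ).2.2
      rw [hw φ hφ] at this ⊢
      exact Finset.mem_image_of_mem _ ((G.mem_neighborFinset _ _).2 this.symm)
    have hboth : ∀ w z, (∀ φ ∈ F, φ d.fst = w ∧ φ d.snd = z) →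
        ((F.image fun φ => (φ d.fst, φ d.snd)).card : ℝ) ≤ 1 := fun w z hw => by
      refine (hfix {(w, z)} fun φ hφ => ?_).trans (by simp)
      rw [(hw φ hφ).1, (hw φ hφ).2]
      exact Finset.mem_singleton_self _
    have hgen : ((F.image fun φ => (φ d.fst, φ d.snd)).card : ℝ) ≤ M := by
      refine le_trans ?_ hM
      rw [← card_adj_pairs]
      exact hfix _ fun φ hφ => Finset.mem_filter.2 ⟨Finset.mem_univ _, (hmem φ hφ).2.2⟩
    have hedge : d.edge = s(a, b) ↔ (d.fst = a ∧ d.snd = b) ∨ (d.fst = b ∧ d.snd = a) := by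
      have : d.edge = s(d.fst, d.snd) := rfl
      rw [this, Sym2.eq_iff]
    have hne := d.adj.ne
    have c1 : M * ((G.degree u : ℝ) / M) = G.degree u := by field_simp
    have c2 : M * ((G.degree v : ℝ) / M) = G.degree v := by field_simp
    have c3 : M * ((G.degree u : ℝ) / M) * ((G.degree v : ℝ) / M) *
      (M / (G.degree u * G.degree v)) = 1 := by field_simp
    by_cases h1 : d.fst = a
    · have h2 : d.snd ≠ a := fun h => hne (h1.trans h.symm)
      have h3 : d.fst ≠ b := fun h => hab (h1.symm.trans h)
      by_cases h4 : d.snd = b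
      · rw [if_pos h1, if_neg h2, if_neg h3, if_pos h4, if_pos (hedge.2 (Or.inl ⟨h1, h4⟩)),
          mul_one, mul_one, c3]
        exact hboth u v fun φ hφ => ⟨h1 ▸ (hmem φ hφ).1, h4 ▸ (hmem φ hφ).2.1⟩
      · rw [if_pos h1, if_neg h2, if_neg h3, if_neg h4, if_neg (by tauto)]
        simp only [mul_one, c1]
        exact hfst u fun φ hφ => h1 ▸ (hmem φ hφ).1
    · by_cases h2 : d.snd = a
      · have h4 : d.snd ≠ b := fun h => hab (h2.symm.trans h)
        by_cases h3 : d.fst = b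
        · rw [if_neg h1, if_pos h2, if_pos h3, if_neg h4, if_pos (hedge.2 (Or.inr ⟨h3, h2⟩)),
            mul_one, mul_one, c3]
          exact hboth v u fun φ hφ => ⟨h3 ▸ (hmem φ hφ).2.1, h2 ▸ (hmem φ hφ).1⟩
        · rw [if_neg h1, if_pos h2, if_neg h3, if_neg h4, if_neg (by tauto)]
          simp only [mul_one, c1]
          exact hsnd u fun φ hφ => h2 ▸ (hmem φ hφ).1
      · rw [if_neg h1, if_neg h2, if_neg (show ¬ d.edge = s(a, b) by tauto)]
        by_cases h3 : d.fst = b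
        · have h4 : d.snd ≠ b := fun h => hne (h3.trans h.symm)
          rw [if_pos h3, if_neg h4]
          simp only [mul_one, c2]
          exact hfst v fun φ hφ => h3 ▸ (hmem φ hφ).2.1
        · by_cases h4 : d.snd = b
          · rw [if_neg h3, if_pos h4]
            simp only [mul_one, c2]
            exact hsnd v fun φ hφ => h4 ▸ (hmem φ hφ).2.1
          · rw [if_neg h3, if_neg h4]
            simpa only [mul_one] using hgen

open Classical in
/-- If every edge of `G` lies in many copies of the regular graph `H`, then the product of the
degrees of the end points of an edge is large. -/
theorem exists_le_degree_mul_degree {V : Type*} [Fintype V] (H : SimpleGraph V) {Δ : ℕ}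
    (hΔ : 2 ≤ Δ) (hreg : ∀ a, H.degree a = Δ) (hV : 2 ≤ Fintype.card V) {c₀ C : ℝ} (hc₀ : 0 < c₀)
    (hC : 0 < C) :
    ∃ c : ℝ, 0 < c ∧ ∀ (X : Type) [Fintype X] (G : SimpleGraph X) (x : ℝ), 0 < x →
      ((∑ u, G.degree u : ℕ) : ℝ) ≤ C * x ^ 2 → ∀ u v, G.Adj u v →
      c₀ * x ^ (Fintype.card V - 2) ≤ (labelledCopyCountThrough G H s(u, v) : ℝ) →
      c * x ^ 2 ≤ (G.degree u : ℝ) * G.degree v := by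
  obtain ⟨w, hw⟩ : ∃ w, Fintype.card V = w + 2 := ⟨Fintype.card V - 2, by omega⟩
  obtain ⟨k, rfl⟩ : ∃ k, Δ = k + 2 := ⟨Δ - 2, by omega⟩
  have hN : (0 : ℝ) < ((w + 2) * (k + 2) : ℕ) := by positivity
  set c₁ : ℝ := (c₀ / ((w + 2) * (k + 2) : ℕ)) ^ (2 * (k + 2)) * C ^ (4 * (k + 2) - 2) /
    C ^ ((w + 2) * (k + 2)) with hc₁
  have hc₁0 : 0 < c₁ := by positivity
  -- Powers of `min 1 c₁` stay below `c₁`, which avoids extracting a (2Δ−2)-th root.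
  refine ⟨min 1 c₁, lt_min one_pos hc₁0, fun X _ G x hx hM u v huv hcop => ?_⟩
  have hcard : (Finset.univ : Finset H.Dart).card = (w + 2) * (k + 2) := by
    rw [Finset.card_univ, H.dart_card_eq_sum_degrees]
    simp [hreg, hw]
  have hd : ∃ d : H.Dart, c₀ * x ^ w / ((w + 2) * (k + 2) : ℕ) ≤
      (((copyMaps H G).filter fun φ => φ d.fst = u ∧ φ d.snd = v).card : ℝ) := by
    by_contra! hcon
    have hne : (Finset.univ : Finset H.Dart).Nonempty := by
      rw [← Finset.card_pos, hcard]
      positivity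
    have h1 := Finset.sum_lt_sum_of_nonempty hne fun d _ => hcon d
    rw [Finset.sum_const, hcard, nsmul_eq_mul, mul_div_cancel₀ _ hN.ne'] at h1
    have h2 : (labelledCopyCountThrough G H s(u, v) : ℝ) ≤
      ∑ d : H.Dart, (((copyMaps H G).filter fun φ => φ d.fst = u ∧ φ d.snd = v).card : ℝ) := by
      exact_mod_cast labelledCopyCountThrough_le H G u v
    rw [hw, Nat.add_sub_cancel] at hcop
    linarith
  obtain ⟨d, hd⟩ := hd
  have key := card_pinned_copyMaps_pow_le H (by omega) hreg G (M := C * x ^ 2) (by positivity) hM d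
    huv
  rw [hw] at key
  set P : ℝ := (G.degree u : ℝ) * G.degree v with hP
  have hP0 : 0 ≤ P := by positivity
  have h3 : (c₀ * x ^ w / ((w + 2) * (k + 2) : ℕ)) ^ (2 * (k + 2)) * (C * x ^ 2) ^ (4 * (k + 2) - 2)
      ≤ (C * x ^ 2) ^ ((w + 2) * (k + 2)) * P ^ (2 * (k + 2) - 2) :=
    (mul_le_mul_of_nonneg_right (pow_le_pow_left₀ (by positivity) hd _) (by positivity)).trans key
  have e1 : 4 * (k + 2) - 2 = 4 * k + 6 := by omega
  have e2 : 2 * (k + 2) - 2 = 2 * k + 2 := by omega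
  rw [e1] at hc₁ h3
  rw [e2] at h3
  -- The powers of x balance: 2Δ(v−2) + 2(4Δ−2) − 2vΔ = 2(2Δ−2).
  have h4 : c₁ * (x ^ 2) ^ (2 * k + 2) ≤ P ^ (2 * k + 2) := by
    have h5 : (C * x ^ 2) ^ ((w + 2) * (k + 2)) * (c₁ * (x ^ 2) ^ (2 * k + 2)) ≤
        (C * x ^ 2) ^ ((w + 2) * (k + 2)) * P ^ (2 * k + 2) := by
      refine le_trans (le_of_eq ?_) h3
      have : C ^ ((w + 2) * (k + 2)) * c₁ =
          (c₀ / ((w + 2) * (k + 2) : ℕ)) ^ (2 * (k + 2)) * C ^ (4 * k + 6) := by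
        rw [hc₁]
        field_simp
      rw [mul_pow C (x ^ 2) ((w + 2) * (k + 2)),
        show C ^ ((w + 2) * (k + 2)) * (x ^ 2) ^ ((w + 2) * (k + 2)) *
          (c₁ * (x ^ 2) ^ (2 * k + 2)) = (C ^ ((w + 2) * (k + 2)) * c₁) *
          ((x ^ 2) ^ ((w + 2) * (k + 2)) * (x ^ 2) ^ (2 * k + 2)) by ring, this,
        mul_div_right_comm, mul_pow, mul_pow, ← pow_mul, ← pow_mul, ← pow_mul, ← pow_mul]
      ring
    exact le_of_mul_le_mul_left h5 (by positivity)
  by_contra! hlt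
  have h5 : P ^ (2 * k + 2) < (min 1 c₁ * x ^ 2) ^ (2 * k + 2) :=
    pow_lt_pow_left₀ hlt hP0 (by omega)
  have h6 : (min 1 c₁) ^ (2 * k + 2) ≤ c₁ :=
    (pow_le_of_le_one (lt_min one_pos hc₁0).le (min_le_left _ _) (by omega)).trans (min_le_right _ _)
  rw [mul_pow (min 1 c₁)] at h5
  have h7 := mul_le_mul_of_nonneg_right h6 (show 0 ≤ (x ^ 2) ^ (2 * k + 2) by positivity)
  linarith

/-! ### Copies alternating between low vertices and their neighbours -/

/-- `2 d (d - 1) ⋯ (d - Δ + 1) ≤ (2 d - Δ) ^ Δ`. -/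
theorem two_mul_descFactorial_le {Δ d : ℕ} (hΔ : 2 ≤ Δ) (hd : Δ ≤ d) :
    2 * d.descFactorial Δ ≤ (2 * d - Δ) ^ Δ := by
  obtain ⟨k, rfl⟩ := Nat.exists_eq_add_of_le hd
  obtain ⟨j, rfl⟩ : ∃ j, Δ = j + 1 := ⟨Δ - 1, by omega⟩
  rw [Nat.descFactorial_succ, Nat.add_right_comm j 1 k, pow_succ]
  -- The smallest factor absorbs the 2, since 2(d−Δ+1) ≤ 2d−Δ exactly when Δ ≥ 2. The others are at
  -- most d ≤ 2d−Δ.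
  calc 2 * ((j + k + 1 - j) * (j + k + 1).descFactorial j)
      = (j + k + 1).descFactorial j * (2 * (k + 1)) := by
        rw [show j + k + 1 - j = k + 1 by omega]
        ring
    _ ≤ (2 * (j + k + 1) - (j + 1)) ^ j * (2 * (j + k + 1) - (j + 1)) :=
        Nat.mul_le_mul ((Nat.descFactorial_le_pow _ _).trans
          (Nat.pow_le_pow_left (by omega) _)) (by omega)

open Classical in
/-- The number of restrictions to `s` of injective maps sending `s` into `t`. -/
theorem traceCard_le_descFactorial {V X : Type*} [Fintype X] (F : Finset (V → X)) (s : Finset V)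
    (t : Finset X) (hinj : ∀ φ ∈ F, Function.Injective φ) (hmap : ∀ φ ∈ F, ∀ a ∈ s, φ a ∈ t) :
    traceCard F s ≤ t.card.descFactorial s.card := by
  have h := Fintype.card_embedding_eq (α := s) (β := t)
  rw [Fintype.card_coe, Fintype.card_coe] at h
  rw [← h, ← Finset.card_univ]
  refine (Finset.card_le_card fun g hg => ?_).trans
    (Finset.card_image_le (f := fun e : s ↪ t => fun a => (e a : X)))
  obtain ⟨φ, hφ, rfl⟩ := Finset.mem_image.1 hg
  refine Finset.mem_image.2 ⟨⟨fun a => ⟨φ a, hmap φ hφ a a.2⟩, fun a b hab => ?_⟩,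
    Finset.mem_univ _, rfl⟩
  exact Subtype.ext (hinj φ hφ (Subtype.ext_iff.1 hab))

open Classical in
/-- Two-colour classes of a connected graph agree as soon as they agree at one vertex. -/
theorem twoColoring_unique {V : Type*} [Fintype V] {H : SimpleGraph V} (hconn : H.Connected)
    {S T : Finset V} (hS : ∀ a b, H.Adj a b → (a ∈ S ↔ b ∉ S))
    (hT : ∀ a b, H.Adj a b → (a ∈ T ↔ b ∉ T)) {v : V} (hv : v ∈ S ↔ v ∈ T) : S = T := by
  ext w
  obtain ⟨p⟩ := hconn.preconnected v w
  induction p with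
  | nil => exact hv
  | cons hadj _ ih =>
    apply ih
    have h1 := hS _ _ hadj
    have h2 := hT _ _ hadj
    tauto

-- Counting the edges between the two classes from either side shows that they have equal size.
open Classical in
theorem two_mul_card_twoColoring {V : Type*} [Fintype V] {H : SimpleGraph V} {Δ : ℕ} (hΔ : 0 < Δ)
    (hreg : ∀ a, H.degree a = Δ) {S : Finset V} (hS : ∀ a b, H.Adj a b → (a ∈ S ↔ b ∉ S)) :
    2 * S.card = Fintype.card V := by
  have hbip : H.IsBipartiteWith (S : Set V) ((Sᶜ : Finset V) : Set V) := by
    refine ⟨by rw [Finset.coe_compl]; exact disjoint_compl_right, fun a b hab => ?_⟩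
    have := hS a b hab
    simp only [Finset.mem_coe, Finset.mem_compl]
    tauto
  have h := SimpleGraph.isBipartiteWith_sum_degrees_eq hbip
  simp only [hreg, Finset.sum_const, smul_eq_mul] at h
  have h2 := Nat.eq_of_mul_eq_mul_right hΔ h
  rw [two_mul]
  nth_rw 2 [h2]
  exact Finset.card_add_card_compl S

open Classical in
/-- The copies of a bipartite regular graph `H` that send one colour class of `H` into a set `L` of
vertices of degree at least `Δ`. -/
theorem two_mul_card_bipartite_copyMaps_le {V X : Type*} [Fintype V] [Fintype X] [Nonempty V]
    (H : SimpleGraph V) {Δ : ℕ} (hΔ : 2 ≤ Δ) (hreg : ∀ a, H.degree a = Δ) (G : SimpleGraph X)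
    (L : Finset X) (hL : ∀ u ∈ L, Δ ≤ G.degree u) {S : Finset V}
    (hS : ∀ a b, H.Adj a b → (a ∈ S ↔ b ∉ S)) :
    2 * (((copyMaps H G).filter fun φ => ∀ a ∈ S, φ a ∈ L).card : ℝ) ≤
      (∑ u ∈ L, (2 * (G.degree u : ℝ) - Δ)) ^ S.card := by
  set F := (copyMaps H G).filter fun φ => ∀ a ∈ S, φ a ∈ L with hF
  have hΔr : (0 : ℝ) < Δ := by exact_mod_cast (by omega : 0 < Δ)
  have hg : ∀ u ∈ L, (0 : ℝ) ≤ 2 * (G.degree u : ℝ) - Δ := fun u hu => by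
    have : (Δ : ℝ) ≤ G.degree u := by exact_mod_cast hL u hu
    linarith
  -- A vertex outside `S` has all its Δ neighbours in `S`. The bound is what makes (1/2)^{|S|/Δ} at
  -- most 1/2 below.
  have hSΔ : Δ ≤ S.card := by
    have hsub : ∀ b, b ∉ S → H.neighborFinset b ⊆ S := fun b hb a ha => by
      have := hS b a ((H.mem_neighborFinset _ _).1 ha)
      tauto
    by_contra! hlt
    have hall : ∀ b, b ∈ S := fun b => by
      by_contra hb
      have := Finset.card_le_card (hsub b hb)
      rw [H.card_neighborFinset_eq_degree, hreg] at this
      omega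
    obtain ⟨a⟩ := ‹Nonempty V›
    obtain ⟨b, hb⟩ := (H.degree_pos_iff_exists_adj a).1 (by rw [hreg]; omega)
    exact (hS a b hb).1 (hall a) (hall b)
  -- With the copy fixed on `S`, the neighbourhoods of vertices of `S` cover each remaining vertex
  -- exactly Δ times. Shearer and injectivity bound the extensions by a product of falling
  -- factorials to the power 1/Δ.
  have hfib : ∀ ψ : ↥S → X, (∀ a, ψ a ∈ L) →
      ((F.filter fun φ => S.restrict φ = ψ).card : ℝ) ≤
        ∏ a, ((2 : ℝ)⁻¹ ^ ((Δ : ℝ)⁻¹) * (2 * (G.degree (ψ a) : ℝ) - Δ)) := by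
    intro ψ hψ
    set Φ := F.filter fun φ => S.restrict φ = ψ with hΦ
    have hΦm : ∀ φ ∈ Φ, φ ∈ copyMaps H G ∧ S.restrict φ = ψ := fun φ hφ =>
      ⟨(Finset.mem_filter.1 (Finset.mem_filter.1 hφ).1).1, (Finset.mem_filter.1 hφ).2⟩
    have h1 : Φ.card = traceCard Φ Sᶜ := by
      refine (Finset.card_image_of_injOn fun φ hφ φ' hφ' h => funext fun a => ?_).symm
      by_cases ha : a ∈ S
      · exact congrFun ((hΦm φ hφ).2.trans (hΦm φ' hφ').2.symm) ⟨a, ha⟩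
      · exact congrFun h ⟨a, Finset.mem_compl.2 ha⟩
    rw [h1]
    refine (traceCard_le_prod_traceCard_rpow (fun a : ↥S => H.neighborFinset (a : V))
      (k := Δ) (by omega) Sᶜ ?_ Φ).trans ?_
    · intro i hi
      rw [← hreg i, ← H.card_neighborFinset_eq_degree]
      refine Finset.card_bij (fun a _ => (a : V)) ?_ ?_ ?_
      · intro a ha
        have := (H.mem_neighborFinset _ _).1 (Finset.mem_filter.1 ha).2
        exact (H.mem_neighborFinset _ _).2 this.symm
      · intro a _ b _ h
        exact Subtype.ext h
      · intro b hb
        have hadj := (H.mem_neighborFinset _ _).1 hb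
        have hbS : b ∈ S := (hS b i hadj.symm).2 (Finset.mem_compl.1 hi)
        exact ⟨⟨b, hbS⟩, Finset.mem_filter.2 ⟨Finset.mem_univ _,
          (H.mem_neighborFinset _ _).2 hadj.symm⟩, rfl⟩
    · refine Finset.prod_le_prod (fun _ _ => by positivity) fun a _ => ?_
      have hsub : H.neighborFinset (a : V) ∩ Sᶜ = H.neighborFinset (a : V) := by
        refine Finset.inter_eq_left.2 fun b hb => Finset.mem_compl.2 ?_
        exact (hS _ _ ((H.mem_neighborFinset _ _).1 hb)).1 a.2
      rw [hsub]
      have h2 := traceCard_le_descFactorial Φ (H.neighborFinset (a : V)) (G.neighborFinset (ψ a))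
        (fun φ hφ => (mem_copyMaps.1 (hΦm φ hφ).1).1) (fun φ hφ b hb => by
          rw [← (hΦm φ hφ).2]
          exact (G.mem_neighborFinset _ _).2 ((mem_copyMaps.1 (hΦm φ hφ).1).2 _ _
            ((H.mem_neighborFinset _ _).1 hb)))
      rw [H.card_neighborFinset_eq_degree, G.card_neighborFinset_eq_degree, hreg] at h2
      have h3 := two_mul_descFactorial_le hΔ (hL _ (hψ a))
      have h4 : (traceCard Φ (H.neighborFinset (a : V)) : ℝ) ≤
          2⁻¹ * (2 * (G.degree (ψ a) : ℝ) - Δ) ^ Δ := by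
        have h5 : ((2 * traceCard Φ (H.neighborFinset (a : V)) : ℕ) : ℝ) ≤
            ((2 * G.degree (ψ a) - Δ : ℕ) : ℝ) ^ Δ := by
          exact_mod_cast (Nat.mul_le_mul_left 2 h2).trans h3
        rw [Nat.cast_sub (by have := hL _ (hψ a); omega)] at h5
        push_cast at h5
        linarith
      refine (Real.rpow_le_rpow (by positivity) h4 (by positivity)).trans (le_of_eq ?_)
      rw [Real.mul_rpow (by positivity) (pow_nonneg (hg _ (hψ a)) _),
        Real.pow_rpow_inv_natCast (hg _ (hψ a)) (by omega)]
  have hsum : (F.card : ℝ) ≤ ∑ ψ ∈ Fintype.piFinset fun _ : ↥S => L,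
      ∏ a, ((2 : ℝ)⁻¹ ^ ((Δ : ℝ)⁻¹) * (2 * (G.degree (ψ a) : ℝ) - Δ)) := by
    have h1 := Finset.card_eq_sum_card_fiberwise (s := F) (f := fun φ => S.restrict φ)
      (t := Fintype.piFinset fun _ : ↥S => L) (fun φ hφ => by
        rw [Finset.mem_coe, Fintype.mem_piFinset]
        exact fun a => (Finset.mem_filter.1 hφ).2 a a.2)
    rw [h1, Nat.cast_sum]
    exact Finset.sum_le_sum fun ψ hψ => hfib ψ (Fintype.mem_piFinset.1 hψ)
  rw [← Finset.prod_univ_sum (fun _ : ↥S => L)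
    (fun _ u => (2 : ℝ)⁻¹ ^ ((Δ : ℝ)⁻¹) * (2 * (G.degree u : ℝ) - Δ)), Finset.prod_const,
    Finset.card_univ, Fintype.card_coe, ← Finset.mul_sum, mul_pow] at hsum
  have hpow : ((2 : ℝ)⁻¹ ^ ((Δ : ℝ)⁻¹)) ^ S.card ≤ 2⁻¹ := by
    rw [← Real.rpow_mul_natCast (by norm_num)]
    calc (2 : ℝ)⁻¹ ^ ((Δ : ℝ)⁻¹ * S.card) ≤ (2 : ℝ)⁻¹ ^ (1 : ℝ) := by
          refine Real.rpow_le_rpow_of_exponent_ge (by norm_num) (by norm_num) ?_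
          rw [inv_mul_eq_div, one_le_div hΔr]
          exact_mod_cast hSΔ
      _ = 2⁻¹ := Real.rpow_one _
  have hs0 : 0 ≤ (∑ u ∈ L, (2 * (G.degree u : ℝ) - Δ)) ^ S.card :=
    pow_nonneg (Finset.sum_nonneg hg) _
  have := mul_le_mul_of_nonneg_right hpow hs0
  linarith

/-! ### The discounted bound on the number of copies -/

open Classical in
theorem card_adj_pairs_fst {X : Type*} [Fintype X] (G : SimpleGraph X) (L : Finset X) :
    (Finset.univ.filter fun z : X × X => G.Adj z.1 z.2 ∧ z.1 ∈ L).card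
      = ∑ u ∈ L, G.degree u := by
  rw [Finset.card_filter, Fintype.sum_prod_type, ← Finset.sum_subset (Finset.subset_univ L)]
  · refine Finset.sum_congr rfl fun u hu => ?_
    rw [← Finset.card_filter, ← G.card_neighborFinset_eq_degree]
    congr 1
    ext v
    simp [hu]
  · intro u _ hu
    simp [hu]

open Classical in
theorem card_adj_pairs_snd {X : Type*} [Fintype X] (G : SimpleGraph X) (L : Finset X) :
    (Finset.univ.filter fun z : X × X => G.Adj z.1 z.2 ∧ z.2 ∈ L).card
      = ∑ u ∈ L, G.degree u := by
  rw [← card_adj_pairs_fst]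
  refine Finset.card_bij (fun z _ => z.swap) ?_ ?_ ?_
  · intro z hz
    simpa [G.adj_comm] using hz
  · intro z _ z' _ h
    exact Prod.swap_injective h
  · intro z hz
    exact ⟨z.swap, by simpa [G.adj_comm] using hz, Prod.swap_swap z⟩

open Classical in
/-- For an independent set `L`, the number of darts inside a set `W` disjoint from `L`. -/
theorem card_adj_pairs_inside_add_le {X : Type*} [Fintype X] (G : SimpleGraph X) {L W : Finset X}
    (hdisj : Disjoint L W) (hind : ∀ u ∈ L, ∀ v ∈ L, ¬ G.Adj u v) :
    (Finset.univ.filter fun z : X × X => G.Adj z.1 z.2 ∧ z.1 ∈ W ∧ z.2 ∈ W).card +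
      2 * ∑ u ∈ L, G.degree u ≤ ∑ u, G.degree u := by
  rw [two_mul]
  nth_rw 1 [← card_adj_pairs_fst]
  rw [← card_adj_pairs_snd, ← card_adj_pairs, ← Finset.card_union_of_disjoint,
    ← Finset.card_union_of_disjoint]
  · refine Finset.card_le_card fun z hz => ?_
    simp only [Finset.mem_union, Finset.mem_filter, Finset.mem_univ, true_and] at hz ⊢
    tauto
  · rw [Finset.disjoint_union_right]
    constructor
    · rw [Finset.disjoint_filter]
      rintro z _ ⟨_, h, _⟩ ⟨_, h'⟩
      exact Finset.disjoint_left.1 hdisj h' h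
    · rw [Finset.disjoint_filter]
      rintro z _ ⟨_, _, h⟩ ⟨_, h'⟩
      exact Finset.disjoint_left.1 hdisj h' h
  · rw [Finset.disjoint_filter]
    rintro z _ ⟨h, h1⟩ ⟨_, h2⟩
    exact hind _ h1 _ h2 h

open Classical in
theorem card_copyMaps_inside_le {V X : Type*} [Fintype V] [Fintype X] (H : SimpleGraph V) {Δ : ℕ}
    (hΔ : 0 < Δ) (hreg : ∀ a, H.degree a = Δ) (G : SimpleGraph X) (W : Finset X) :
    (((copyMaps H G).filter fun φ => ∀ a, φ a ∈ W).card : ℝ) ≤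
      ((Finset.univ.filter fun z : X × X => G.Adj z.1 z.2 ∧ z.1 ∈ W ∧ z.2 ∈ W).card : ℝ) ^
        ((Fintype.card V : ℝ) / 2) := by
  set m : ℕ := (Finset.univ.filter fun z : X × X => G.Adj z.1 z.2 ∧ z.1 ∈ W ∧ z.2 ∈ W).card
  have key := card_pow_le_prod_darts H hΔ hreg ((copyMaps H G).filter fun φ => ∀ a, φ a ∈ W)
    (fun _ => (m : ℝ)) (fun d => by
      refine Nat.cast_le.2 (Finset.card_le_card (Finset.image_subset_iff.2 fun φ hφ => ?_))
      obtain ⟨h1, h2⟩ := Finset.mem_filter.1 hφ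
      exact Finset.mem_filter.2 ⟨Finset.mem_univ _, (mem_copyMaps.1 h1).2 _ _ d.adj, h2 _, h2 _⟩)
  rw [Finset.prod_const, Finset.card_univ, H.dart_card_eq_sum_degrees] at key
  simp only [hreg, Finset.sum_const, Finset.card_univ, smul_eq_mul] at key
  refine le_of_pow_le_pow_left₀ (n := 2 * Δ) (by omega) (by positivity) (key.trans (le_of_eq ?_))
  rw [← Real.rpow_mul_natCast (by positivity), ← Real.rpow_natCast]
  congr 1
  push_cast
  ring

-- One rare dart suffices: in Shearer's product a single factor `M` is replaced by `E`, so copies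
-- forced through few edges are negligible.
open Classical in
theorem card_copyMaps_dart_le {V X : Type*} [Fintype V] [Fintype X] (H : SimpleGraph V) {Δ : ℕ}
    (hΔ : 0 < Δ) (hreg : ∀ a, H.degree a = Δ) (G : SimpleGraph X) {M E : ℝ}
    (hM : ((∑ u, G.degree u : ℕ) : ℝ) ≤ M) (T : Finset (X × X)) (hE : (T.card : ℝ) ≤ E)
    (d₀ : H.Dart) (F : Finset (V → X)) (hF : F ⊆ copyMaps H G)
    (hFT : ∀ φ ∈ F, (φ d₀.fst, φ d₀.snd) ∈ T) :
    (F.card : ℝ) ≤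
      (E * M ^ (Fintype.card V * Δ - 1)) ^ (((2 * Δ : ℕ) : ℝ)⁻¹) := by
  have hM0 : 0 ≤ M := (Nat.cast_nonneg _).trans hM
  have hE0 : 0 ≤ E := (Nat.cast_nonneg _).trans hE
  have key := card_pow_le_prod_darts H hΔ hreg F
    (fun d => if d = d₀ then E else M) (fun d => by
      split_ifs with h
      · subst h
        exact le_trans (Nat.cast_le.2 (Finset.card_le_card
          (Finset.image_subset_iff.2 hFT))) hE
      · rw [← card_adj_pairs] at hM
        refine le_trans (Nat.cast_le.2 (Finset.card_le_card
          (Finset.image_subset_iff.2 fun φ hφ => ?_))) hM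
        exact Finset.mem_filter.2
          ⟨Finset.mem_univ _, (mem_copyMaps.1 (hF hφ)).2 _ _ d.adj⟩)
  rw [Finset.prod_ite, Finset.prod_const, Finset.prod_const, Finset.filter_eq',
    if_pos (Finset.mem_univ _), Finset.card_singleton, pow_one, Finset.filter_ne',
    Finset.card_erase_of_mem (Finset.mem_univ _), Finset.card_univ,
    H.dart_card_eq_sum_degrees] at key
  simp only [hreg, Finset.sum_const, Finset.card_univ, smul_eq_mul] at key
  refine le_of_pow_le_pow_left₀ (n := 2 * Δ) (by omega) (by positivity) (key.trans (le_of_eq ?_))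
  rw [Real.rpow_inv_natCast_pow (by positivity) (by omega)]

open Classical in
/-- The copies of `H` are inside `W`, or alternate between `L` and its neighbourhood, or use an edge
between the neighbourhood of `L` and `W`. -/
theorem card_copyMaps_le {V X : Type*} [Fintype V] [Fintype X] (H : SimpleGraph V) {Δ : ℕ}
    (hΔ : 2 ≤ Δ) (hreg : ∀ a, H.degree a = Δ) (hconn : H.Connected) (G : SimpleGraph X)
    {L W : Finset X} (hdisj : Disjoint L W) (hLW : ∀ u v, G.Adj u v → u ∈ L ∨ u ∈ W)
    (hind : ∀ u ∈ L, ∀ v ∈ L, ¬ G.Adj u v) (hL : ∀ u ∈ L, Δ ≤ G.degree u) {M E : ℝ}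
    (hM : ((∑ u, G.degree u : ℕ) : ℝ) ≤ M)
    (hE : ((Finset.univ.filter fun z : X × X => G.Adj z.1 z.2 ∧
      ((∃ u ∈ L, G.Adj u z.1) ∧ z.2 ∈ W)).card : ℝ) ≤ E) :
    ((copyMaps H G).card : ℝ) ≤
      (((∑ u, G.degree u : ℕ) : ℝ) - Δ * L.card) ^ ((Fintype.card V : ℝ) / 2) +
        Fintype.card V * Δ *
          (E * M ^ (Fintype.card V * Δ - 1)) ^ (((2 * Δ : ℕ) : ℝ)⁻¹) := by
  have hne : Nonempty V := hconn.nonempty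
  have hnbr : ∀ a, ∃ b, H.Adj a b := fun a =>
    (H.degree_pos_iff_exists_adj a).1 (by rw [hreg]; omega)
  set 𝒯 : Finset (Finset V) := Finset.univ.filter fun S => ∀ a b, H.Adj a b → (a ∈ S ↔ b ∉ S)
    with h𝒯
  set FW := (copyMaps H G).filter fun φ => ∀ a, φ a ∈ W with hFW
  set FS := fun S : Finset V => (copyMaps H G).filter fun φ => ∀ a ∈ S, φ a ∈ L with hFS
  set FD := fun d : H.Dart => (copyMaps H G).filter fun φ =>
    (∃ u ∈ L, G.Adj u (φ d.fst)) ∧ φ d.snd ∈ W with hFD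
  -- A copy not inside `W` has a vertex in `L`. If no dart goes from the neighbourhood of `L` to
  -- `W`, then following walks in `H` shows that membership in `L` alternates, so the preimage of
  -- `L` is a colour class.
  have hcover : copyMaps H G ⊆ FW ∪ 𝒯.biUnion FS ∪ Finset.univ.biUnion FD := by
    intro φ hφ
    have hadj := (mem_copyMaps.1 hφ).2
    by_contra hcon
    simp only [Finset.mem_union, not_or, Finset.mem_biUnion, Finset.mem_univ, true_and] at hcon
    obtain ⟨⟨hW, hS⟩, hD⟩ := hcon
    have hW' : ∃ a, φ a ∉ W := by
      by_contra! h
      exact hW (Finset.mem_filter.2 ⟨hφ, h⟩)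
    have hD' : ∀ a b, H.Adj a b → (∃ u ∈ L, G.Adj u (φ a)) → φ b ∈ L := by
      intro a b hab hu
      rcases hLW _ _ (hadj b a hab.symm) with h | h
      · exact h
      · exact absurd ⟨⟨(a, b), hab⟩, Finset.mem_filter.2 ⟨hφ, hu, h⟩⟩ hD
    obtain ⟨a₀, ha₀⟩ := hW'
    have hall : ∀ a, φ a ∈ L ∨ ∃ u ∈ L, G.Adj u (φ a) := by
      intro a
      have h0 : φ a₀ ∈ L ∨ ∃ u ∈ L, G.Adj u (φ a₀) := by
        obtain ⟨b, hb⟩ := hnbr a₀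
        exact Or.inl ((hLW _ _ (hadj _ _ hb)).resolve_right ha₀)
      obtain ⟨p⟩ := hconn.preconnected a₀ a
      clear ha₀
      induction p with
      | nil => exact h0
      | cons h _ ih =>
        refine ih ?_
        rcases h0 with h0 | h0
        · exact Or.inr ⟨_, h0, hadj _ _ h⟩
        · exact Or.inl (hD' _ _ h h0)
    refine hS ⟨Finset.univ.filter fun a => φ a ∈ L, ?_, ?_⟩
    · refine Finset.mem_filter.2 ⟨Finset.mem_univ _, fun a b hab => ?_⟩
      simp only [Finset.mem_filter, Finset.mem_univ, true_and]
      constructor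
      · intro ha hb
        exact hind _ ha _ hb (hadj _ _ hab)
      · intro hb
        exact hD' b a hab.symm ((hall b).resolve_left hb)
    · exact Finset.mem_filter.2 ⟨hφ, fun a ha => (Finset.mem_filter.1 ha).2⟩
  have hcard : ((copyMaps H G).card : ℝ) ≤ FW.card + ∑ S ∈ 𝒯, ((FS S).card : ℝ) +
      ∑ d, ((FD d).card : ℝ) := by
    have h := (Finset.card_le_card hcover).trans ((Finset.card_union_le _ _).trans
      (Nat.add_le_add ((Finset.card_union_le _ _).trans
        (Nat.add_le_add_left Finset.card_biUnion_le _)) Finset.card_biUnion_le))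
    exact_mod_cast h
  set Y : ℝ := ∑ u ∈ L, (2 * (G.degree u : ℝ) - Δ) with hY
  have hY0 : 0 ≤ Y := Finset.sum_nonneg fun u hu => by
    have : (Δ : ℝ) ≤ G.degree u := by exact_mod_cast hL u hu
    linarith
  have hS : ∑ S ∈ 𝒯, ((FS S).card : ℝ) ≤ Y ^ ((Fintype.card V : ℝ) / 2) := by
    have h1 : ∀ S ∈ 𝒯, ((FS S).card : ℝ) ≤ 2⁻¹ * Y ^ ((Fintype.card V : ℝ) / 2) := by
      intro S hST
      have hcol := (Finset.mem_filter.1 hST).2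
      have h2 := two_mul_card_bipartite_copyMaps_le H hΔ hreg G L hL hcol
      have h3 := two_mul_card_twoColoring (by omega) hreg hcol
      have h4 : ((Fintype.card V : ℝ) / 2) = S.card := by
        rw [← h3]
        push_cast
        ring
      rw [h4, Real.rpow_natCast]
      linarith
    -- The two possible colour classes cancel the factor 1/2 gained for each.
    have h2 : 𝒯.card ≤ 2 := by
      obtain ⟨v₀⟩ := hne
      refine (Finset.card_le_card_of_injOn (t := (Finset.univ : Finset Prop)) (fun S => v₀ ∈ S)
        (fun _ _ => Finset.mem_coe.2 (Finset.mem_univ _)) fun S hS T hT h => ?_).trans (by simp)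
      exact twoColoring_unique hconn (Finset.mem_filter.1 hS).2 (Finset.mem_filter.1 hT).2
        (iff_of_eq h)
    calc ∑ S ∈ 𝒯, ((FS S).card : ℝ) ≤ 𝒯.card * (2⁻¹ * Y ^ ((Fintype.card V : ℝ) / 2)) := by
          rw [← nsmul_eq_mul]
          exact Finset.sum_le_card_nsmul _ _ _ h1
      _ ≤ 2 * (2⁻¹ * Y ^ ((Fintype.card V : ℝ) / 2)) := by
          refine mul_le_mul_of_nonneg_right (by exact_mod_cast h2) (by positivity)
      _ = _ := by ring
  have hD : ∑ d, ((FD d).card : ℝ) ≤ Fintype.card V * Δ *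
      (E * M ^ (Fintype.card V * Δ - 1)) ^ (((2 * Δ : ℕ) : ℝ)⁻¹) := by
    have h1 := Finset.sum_le_card_nsmul Finset.univ (fun d => ((FD d).card : ℝ)) _ fun d _ =>
      card_copyMaps_dart_le H (by omega) hreg G hM _ hE d (FD d) (Finset.filter_subset _ _)
        fun φ hφ => Finset.mem_filter.2 ⟨Finset.mem_univ _,
          (mem_copyMaps.1 (Finset.mem_filter.1 hφ).1).2 _ _ d.adj, (Finset.mem_filter.1 hφ).2⟩
    refine h1.trans (le_of_eq ?_)
    rw [Finset.card_univ, H.dart_card_eq_sum_degrees]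
    simp only [hreg, Finset.sum_const, Finset.card_univ, smul_eq_mul, nsmul_eq_mul, Nat.cast_mul]
  have hW := card_copyMaps_inside_le H (by omega) hreg G W
  set m : ℕ := (Finset.univ.filter fun z : X × X => G.Adj z.1 z.2 ∧ z.1 ∈ W ∧ z.2 ∈ W).card
    with hm
  have hmY : (m : ℝ) + Y ≤ ((∑ u, G.degree u : ℕ) : ℝ) - Δ * L.card := by
    have h1 : ((m + 2 * ∑ u ∈ L, G.degree u : ℕ) : ℝ) ≤ ((∑ u, G.degree u : ℕ) : ℝ) := by
      exact_mod_cast card_adj_pairs_inside_add_le G hdisj hind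
    rw [hY, Finset.sum_sub_distrib, ← Finset.mul_sum, Finset.sum_const, nsmul_eq_mul]
    push_cast at h1 ⊢
    linarith
  have hV : (1 : ℝ) ≤ (Fintype.card V : ℝ) / 2 := by
    have h2 : 1 < Fintype.card V := by
      obtain ⟨a⟩ := hne
      obtain ⟨b, hb⟩ := hnbr a
      exact Fintype.one_lt_card_iff.2 ⟨a, b, hb.ne⟩
    have : (2 : ℝ) ≤ Fintype.card V := by exact_mod_cast h2
    linarith
  -- Superadditivity of t ↦ t^{v/2} merges the copies inside `W` with the alternating ones.
  have hadd : (m : ℝ) ^ ((Fintype.card V : ℝ) / 2) + Y ^ ((Fintype.card V : ℝ) / 2) ≤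
      (((∑ u, G.degree u : ℕ) : ℝ) - Δ * L.card) ^ ((Fintype.card V : ℝ) / 2) :=
    (Real.add_rpow_le_rpow_add (by positivity) hY0 hV).trans
      (Real.rpow_le_rpow (by positivity) hmY (by positivity))
  linarith

/-! ### Low and high vertices, and the choice of scale -/

open Classical in
/-- The vertices of positive degree at most `D`. -/
noncomputable def lowVerts {X : Type*} [Fintype X] (G : SimpleGraph X) (D : ℕ) : Finset X :=
  Finset.univ.filter fun u => 0 < G.degree u ∧ G.degree u ≤ D

open Classical in
/-- The vertices of degree more than `D`. -/
noncomputable def highVerts {X : Type*} [Fintype X] (G : SimpleGraph X) (D : ℕ) : Finset X :=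
  Finset.univ.filter fun u => D < G.degree u

open Classical in
theorem mem_lowVerts {X : Type*} [Fintype X] {G : SimpleGraph X} {D : ℕ} {u : X} :
    u ∈ lowVerts G D ↔ 0 < G.degree u ∧ G.degree u ≤ D := by
  simp [lowVerts]

open Classical in
theorem mem_highVerts {X : Type*} [Fintype X] {G : SimpleGraph X} {D : ℕ} {u : X} :
    u ∈ highVerts G D ↔ D < G.degree u := by
  simp [highVerts]

theorem disjoint_lowVerts_highVerts {X : Type*} [Fintype X] (G : SimpleGraph X) (D : ℕ) :
    Disjoint (lowVerts G D) (highVerts G D) :=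
  Finset.disjoint_left.2 fun _ h1 h2 =>
    absurd (mem_highVerts.1 h2) (not_lt.2 (mem_lowVerts.1 h1).2)

open Classical in
theorem mem_lowVerts_or_mem_highVerts {X : Type*} [Fintype X] {G : SimpleGraph X} (D : ℕ) {u v : X}
    (h : G.Adj u v) : u ∈ lowVerts G D ∨ u ∈ highVerts G D := by
  have := (G.degree_pos_iff_exists_adj u).2 ⟨v, h⟩
  rw [mem_lowVerts, mem_highVerts]
  omega

open Classical in
/-- Markov's inequality for degrees. -/
theorem card_mul_le_sum_degree {X : Type*} [Fintype X] (G : SimpleGraph X) (A : Finset X) {t : ℝ}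
    (h : ∀ u ∈ A, t ≤ G.degree u) : A.card * t ≤ ((∑ u, G.degree u : ℕ) : ℝ) := by
  rw [← nsmul_eq_mul]
  refine (Finset.card_nsmul_le_sum A (fun u => (G.degree u : ℝ)) t h).trans ?_
  rw [Nat.cast_sum]
  exact Finset.sum_le_univ_sum_of_nonneg fun _ => Nat.cast_nonneg _

open Classical in
theorem not_adj_of_mem_lowVerts {X : Type*} [Fintype X] {G : SimpleGraph X} {D : ℕ} {y : ℝ}
    (hy : (D : ℝ) ^ 2 < y) (hedge : ∀ u v, G.Adj u v → y ≤ (G.degree u : ℝ) * G.degree v) :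
    ∀ u ∈ lowVerts G D, ∀ v ∈ lowVerts G D, ¬ G.Adj u v := by
  intro u hu v hv h
  have h1 : (G.degree u : ℝ) ≤ D := by exact_mod_cast (mem_lowVerts.1 hu).2
  have h2 : (G.degree v : ℝ) ≤ D := by exact_mod_cast (mem_lowVerts.1 hv).2
  have h3 : (G.degree u : ℝ) * G.degree v ≤ D * D := mul_le_mul h1 h2 (by positivity) (by positivity)
  have := hedge u v h
  nlinarith

open Classical in
/-- Edges between the neighbourhood of the low vertices at one scale and the high vertices at that
scale are few, up to those at vertices between this scale and the next. -/
theorem card_adj_low_neighbors_le {X : Type*} [Fintype X] (G : SimpleGraph X) {D D' : ℕ}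
    (hD : 0 < D) (hD' : 0 < D') {y M : ℝ} (hy : 0 < y)
    (hM : ((∑ u, G.degree u : ℕ) : ℝ) ≤ M)
    (hedge : ∀ u v, G.Adj u v → y ≤ (G.degree u : ℝ) * G.degree v) :
    ((Finset.univ.filter fun z : X × X => G.Adj z.1 z.2 ∧
      ((∃ u ∈ lowVerts G D, G.Adj u z.1) ∧ z.2 ∈ highVerts G D)).card : ℝ) ≤
      ((∑ u ∈ highVerts G D \ highVerts G D', G.degree u : ℕ) : ℝ) + M * D / y * (M / D') := by
  set A : Finset X := Finset.univ.filter fun a => ∃ u ∈ lowVerts G D, G.Adj u a with hA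
  have hDr : (0 : ℝ) < D := by exact_mod_cast hD
  have hDr' : (0 : ℝ) < D' := by exact_mod_cast hD'
  -- A neighbour of a low vertex has degree at least y/D, so Markov's inequality applies.
  have hAc : (A.card : ℝ) ≤ M * D / y := by
    have h := card_mul_le_sum_degree G A (t := y / D) fun a ha => by
      obtain ⟨u, hu, hua⟩ := (Finset.mem_filter.1 ha).2
      have h1 : (G.degree u : ℝ) ≤ D := by exact_mod_cast (mem_lowVerts.1 hu).2
      rw [div_le_iff₀ hDr]
      have := hedge u a hua
      nlinarith [(Nat.cast_nonneg (G.degree a) : (0 : ℝ) ≤ G.degree a)]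
    rw [le_div_iff₀ hy]
    have h2 := h.trans hM
    rw [← mul_div_assoc, div_le_iff₀ hDr] at h2
    exact h2
  have hWc : ((highVerts G D').card : ℝ) ≤ M / D' := by
    have h := card_mul_le_sum_degree G (highVerts G D') (t := D') fun a ha => by
      exact_mod_cast (mem_highVerts.1 ha).le
    rw [le_div_iff₀ hDr']
    exact h.trans hM
  have hsub : (Finset.univ.filter fun z : X × X => G.Adj z.1 z.2 ∧
      ((∃ u ∈ lowVerts G D, G.Adj u z.1) ∧ z.2 ∈ highVerts G D)) ⊆
      (Finset.univ.filter fun z : X × X => G.Adj z.1 z.2 ∧ z.2 ∈ highVerts G D \ highVerts G D') ∪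
        A ×ˢ highVerts G D' := by
    intro z hz
    obtain ⟨h1, h2, h3⟩ := (Finset.mem_filter.1 hz).2
    by_cases h4 : z.2 ∈ highVerts G D'
    · exact Finset.mem_union_right _ (Finset.mem_product.2
        ⟨Finset.mem_filter.2 ⟨Finset.mem_univ _, h2⟩, h4⟩)
    · exact Finset.mem_union_left _ (Finset.mem_filter.2
        ⟨Finset.mem_univ _, h1, Finset.mem_sdiff.2 ⟨h3, h4⟩⟩)
  have h := (Finset.card_le_card hsub).trans (Finset.card_union_le _ _)
  rw [card_adj_pairs_snd, Finset.card_product] at h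
  refine (Nat.cast_le.2 h).trans ?_
  rw [Nat.cast_add, Nat.cast_mul]
  gcongr
  exact (Nat.cast_nonneg _).trans hAc

-- The degree windows between consecutive scales are disjoint, so their degree sums total at most
-- `M` and one of them is at most the average.
open Classical in
theorem exists_window_le {X : Type*} [Fintype X] (G : SimpleGraph X) {D : ℕ → ℕ} (hD : Monotone D)
    {J : ℕ} (hJ : 0 < J) {M : ℝ} (hM : ((∑ u, G.degree u : ℕ) : ℝ) ≤ M) :
    ∃ j < J, ((∑ u ∈ highVerts G (D j) \ highVerts G (D (j + 1)), G.degree u : ℕ) : ℝ) ≤ M / J := by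
  have hJr : (0 : ℝ) < J := by exact_mod_cast hJ
  have hdis : ∀ i ∈ (Finset.range J : Finset ℕ), ∀ j ∈ (Finset.range J : Finset ℕ), i ≠ j →
      Disjoint (highVerts G (D i) \ highVerts G (D (i + 1)))
        (highVerts G (D j) \ highVerts G (D (j + 1))) := by
    have hlt : ∀ i j, i < j → Disjoint (highVerts G (D i) \ highVerts G (D (i + 1)))
        (highVerts G (D j) \ highVerts G (D (j + 1))) := by
      intro i j hij
      refine Finset.disjoint_left.2 fun u h1 h2 => ?_
      have h3 := (Finset.mem_sdiff.1 h1).2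
      have h4 := mem_highVerts.1 (Finset.mem_sdiff.1 h2).1
      exact h3 (mem_highVerts.2 ((hD (Nat.succ_le_of_lt hij)).trans_lt h4))
    intro i _ j _ hij
    rcases lt_or_gt_of_ne hij with h | h
    · exact hlt i j h
    · exact (hlt j i h).symm
  have hsum : ∑ j ∈ Finset.range J,
      ((∑ u ∈ highVerts G (D j) \ highVerts G (D (j + 1)), G.degree u : ℕ) : ℝ) ≤ M := by
    refine le_trans ?_ hM
    rw [← Nat.cast_sum, ← Finset.sum_biUnion hdis]
    exact Nat.cast_le.2 (Finset.sum_le_sum_of_subset (Finset.subset_univ _))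
  obtain ⟨j, hj, h⟩ := Finset.exists_le_of_sum_le (s := Finset.range J)
    (Finset.nonempty_range_iff.2 hJ.ne') (f := fun j =>
      ((∑ u ∈ highVerts G (D j) \ highVerts G (D (j + 1)), G.degree u : ℕ) : ℝ))
    (g := fun _ => M / J) (by
      rw [Finset.sum_const, Finset.card_range, nsmul_eq_mul, mul_div_cancel₀ _ hJr.ne']
      exact hsum)
  exact ⟨j, Finset.mem_range.1 hj, h⟩

open Classical in
/-- At one of boundedly many scales, the number of copies of `H` is governed by the number of edges,
with a discount for the vertices of low degree. -/
theorem exists_scale_card_copyMaps_le {V : Type*} [Fintype V] (H : SimpleGraph V) {Δ : ℕ}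
    (hΔ : 2 ≤ Δ) (hreg : ∀ a, H.degree a = Δ) (hconn : H.Connected) {c C κ : ℝ} (hc : 0 < c)
    (hC : 0 < C) (hκ : 0 < κ) {D₀ : ℕ} (hD₀ : 0 < D₀) :
    ∃ (J : ℕ) (D : ℕ → ℕ) (x₀ : ℝ), 0 < J ∧ (∀ j, D₀ ≤ D j) ∧ ∀ (X : Type) [Fintype X]
      (G : SimpleGraph X) (x : ℝ), 0 < x → x₀ ≤ x → ((∑ u, G.degree u : ℕ) : ℝ) ≤ C * x ^ 2 →
      (∀ u v, G.Adj u v → c * x ^ 2 ≤ (G.degree u : ℝ) * G.degree v) →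
      (∀ u v, G.Adj u v → Δ ≤ G.degree u) →
      ∃ j < J, (∀ u ∈ lowVerts G (D j), ∀ v ∈ lowVerts G (D j), ¬ G.Adj u v) ∧
        ((copyMaps H G).card : ℝ) ≤
          (((∑ u, G.degree u : ℕ) : ℝ) - Δ * (lowVerts G (D j)).card) ^ ((Fintype.card V : ℝ) / 2) +
            κ * x ^ Fintype.card V := by
  have hne : Nonempty V := hconn.nonempty
  have hv : 0 < Fintype.card V := Fintype.card_pos
  have hvr : (0 : ℝ) < Fintype.card V := by exact_mod_cast hv
  have hΔr : (0 : ℝ) < Δ := by exact_mod_cast (by omega : 0 < Δ)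
  set v := Fintype.card V with hvdef
  -- Solves vΔ(ηC^{vΔ−1})^{1/(2Δ)} = κ, so ηx² darts from the low neighbourhood to the high vertices
  -- cost κx^v. The number `J` of windows and the ratio `Λ` of scales each handle ηx²/2.
  set η : ℝ := (κ / (v * Δ)) ^ (2 * Δ) / C ^ (v * Δ - 1) with hη
  have hη0 : 0 < η := by positivity
  obtain ⟨J, hJ⟩ := exists_nat_gt (2 * C / η)
  obtain ⟨Λ, hΛ⟩ := exists_nat_gt (2 * C ^ 2 / (c * η))
  have hJ0 : (0 : ℝ) < J := lt_trans (by positivity) hJ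
  have hΛ0 : (0 : ℝ) < Λ := lt_trans (by positivity) hΛ
  have hJ0' : 0 < J := by exact_mod_cast hJ0
  have hΛ0' : 0 < Λ := by exact_mod_cast hΛ0
  set D : ℕ → ℕ := fun j => D₀ * Λ ^ j with hD
  have hDm : Monotone D := fun i j hij =>
    Nat.mul_le_mul_left _ (Nat.pow_le_pow_right hΛ0' hij)
  have hDpos : ∀ j, 0 < D j := fun j => by positivity
  -- This threshold forces D_J ≤ x and D_J + 1 ≤ cx, hence D_j² < cx² at every scale used.
  refine ⟨J, D, (D J + 1) / c + 1 + D J, hJ0', fun j => ?_, ?_⟩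
  · exact Nat.le_mul_of_pos_right _ (by positivity)
  intro X _ G x hx hx₀ hM hedge hdeg
  obtain ⟨j, hj, hwin⟩ := exists_window_le G hDm hJ0' hM
  have hDJ : ((D j : ℕ) : ℝ) ≤ D J := by exact_mod_cast hDm hj.le
  have hD2 : ((D j : ℕ) : ℝ) ^ 2 < c * x ^ 2 := by
    have h1 : ((D J : ℕ) : ℝ) + 1 ≤ c * x := by
      have : ((D J : ℕ) + 1 : ℝ) / c ≤ x := by
        have : (0 : ℝ) ≤ D J := Nat.cast_nonneg _
        linarith
      rw [div_le_iff₀ hc] at this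
      linarith
    have h2 : ((D J : ℕ) : ℝ) ≤ x := by
      have : (0 : ℝ) ≤ (D J + 1) / c := by positivity
      linarith
    have h3 : (0 : ℝ) < D j := by exact_mod_cast hDpos j
    calc ((D j : ℕ) : ℝ) ^ 2 ≤ D J * D J := by
          rw [sq]; exact mul_le_mul hDJ hDJ h3.le (h3.le.trans hDJ)
      _ ≤ D J * x := by gcongr
      _ < c * x * x := by gcongr; linarith
      _ = c * x ^ 2 := by ring
  have hind := not_adj_of_mem_lowVerts hD2 hedge
  refine ⟨j, hj, hind, ?_⟩
  have hE := card_adj_low_neighbors_le G (hDpos j) (hDpos (j + 1)) (y := c * x ^ 2) (by positivity)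
    hM hedge
  have hE' : ((Finset.univ.filter fun z : X × X => G.Adj z.1 z.2 ∧
      ((∃ u ∈ lowVerts G (D j), G.Adj u z.1) ∧ z.2 ∈ highVerts G (D j))).card : ℝ) ≤
        η * x ^ 2 := by
    refine hE.trans ((add_le_add_left hwin _).trans ?_)
    have h1 : C * x ^ 2 / J ≤ η / 2 * x ^ 2 := by
      rw [div_lt_iff₀ hη0] at hJ
      rw [div_le_iff₀ hJ0]
      nlinarith [sq_nonneg x]
    have h2 : C * x ^ 2 * (D j : ℕ) / (c * x ^ 2) * (C * x ^ 2 / (D (j + 1) : ℕ)) =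
        C ^ 2 / (c * Λ) * x ^ 2 := by
      have h3 : ((D (j + 1) : ℕ) : ℝ) = D j * Λ := by
        simp only [hD]
        push_cast
        ring
      have h4 : ((D j : ℕ) : ℝ) ≠ 0 := by exact_mod_cast (hDpos j).ne'
      rw [h3]
      field_simp
    have h3 : C ^ 2 / (c * Λ) ≤ η / 2 := by
      rw [div_lt_iff₀ (by positivity)] at hΛ
      rw [div_le_iff₀ (by positivity)]
      linarith
    have h4 : C ^ 2 / (c * Λ) * x ^ 2 ≤ η / 2 * x ^ 2 := by gcongr
    rw [h2]
    linarith
  have hmain := card_copyMaps_le H hΔ hreg hconn G (disjoint_lowVerts_highVerts G (D j))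
    (fun u w h => mem_lowVerts_or_mem_highVerts (D j) h) hind
    (fun u hu => by
      obtain ⟨w, hw⟩ := (G.degree_pos_iff_exists_adj u).1 (mem_lowVerts.1 hu).1
      exact hdeg u w hw) hM hE'
  refine hmain.trans (add_le_add_right (le_of_eq ?_) _)
  have h1 : η * x ^ 2 * (C * x ^ 2) ^ (v * Δ - 1) = (κ / (v * Δ) * x ^ v) ^ (2 * Δ) := by
    have hvΔ : 0 < v * Δ := by positivity
    obtain ⟨k, hk⟩ : ∃ k, v * Δ = k + 1 := ⟨v * Δ - 1, by omega⟩
    have h2 : (x ^ v) ^ (2 * Δ) = (x ^ 2) ^ (k + 1) := by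
      rw [← pow_mul, ← pow_mul, ← hk]
      ring
    have h3 : η * C ^ k = (κ / (v * Δ)) ^ (2 * Δ) := by
      rw [hη, hk, Nat.add_sub_cancel]
      field_simp
    rw [mul_pow (κ / (v * Δ)), h2, ← h3, hk, Nat.add_sub_cancel]
    ring
  rw [← hvdef, h1, Real.pow_rpow_inv_natCast (by positivity) (by omega)]
  field_simp

/-! ### Encoding and counting graphs -/

/-- A finite set can be enumerated in decreasing order of a function on it. -/
theorem exists_enumeration_by_rank {X : Type*} [Nonempty X] (W : Finset X) (f : X → ℕ) :
    ∃ r : ℕ → X, ∀ w ∈ W, ∃ k < (W.filter fun w' => f w ≤ f w').card, r k = w := by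
  classical
  induction W using Finset.induction_on_min_value f with
  | empty => exact ⟨fun _ => Classical.arbitrary X, by simp⟩
  | insert a s ha hmin ih =>
    obtain ⟨r, hr⟩ := ih
    refine ⟨Function.update r s.card a, fun w hw => ?_⟩
    rcases Finset.mem_insert.1 hw with rfl | hws
    · refine ⟨s.card, ?_, Function.update_self _ _ _⟩
      rw [Finset.filter_true_of_mem, Finset.card_insert_of_notMem ha]
      · omega
      · intro x hx
        rcases Finset.mem_insert.1 hx with rfl | hx
        · exact le_rfl
        · exact hmin x hx
    · obtain ⟨k, hk, rfl⟩ := hr w hws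
      have hks : k < s.card := hk.trans_le (Finset.card_filter_le _ _)
      refine ⟨k, hk.trans_le (Finset.card_le_card
        (Finset.filter_subset_filter _ (Finset.subset_insert _ _))), ?_⟩
      rw [Function.update_of_ne hks.ne]

open Classical in
/-- The number of functions supported on `U` with sum at most `M`. -/
theorem card_bounded_sum_le {X : Type*} [Fintype X] (U : Finset X) (M : ℕ) :
    ((Fintype.piFinset fun u : X => if u ∈ U then Finset.range (M + 1) else {0}).filter
      fun d => ∑ u, d u ≤ M).card ≤ 2 ^ (M + U.card) := by
  set 𝒟 := Fintype.piFinset fun u : X => if u ∈ U then Finset.range (M + 1) else {0} with h𝒟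
  have hgeo : ∀ u, ∑ t ∈ (if u ∈ U then Finset.range (M + 1) else {0}), (2 : ℝ)⁻¹ ^ t ≤
      if u ∈ U then 2 else 1 := by
    intro u
    split_ifs
    · have h := Summable.sum_le_tsum (Finset.range (M + 1)) (f := fun t : ℕ => (2 : ℝ)⁻¹ ^ t)
        (fun _ _ => by positivity) (summable_geometric_of_lt_one (by norm_num) (by norm_num))
      refine h.trans (le_of_eq ?_)
      rw [tsum_geometric_of_lt_one (by norm_num) (by norm_num)]
      norm_num
    · simp
  have h1 : ((𝒟.filter fun d => ∑ u, d u ≤ M).card : ℝ) ≤ 2 ^ (M + U.card) := by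
    calc ((𝒟.filter fun d => ∑ u, d u ≤ M).card : ℝ)
        = ∑ d ∈ 𝒟.filter fun d => ∑ u, d u ≤ M, (1 : ℝ) := by simp
      -- The weight 2^{M − ∑ d} is at least 1 and makes the sum factor into geometric series.
      _ ≤ ∑ d ∈ 𝒟.filter fun d => ∑ u, d u ≤ M, 2 ^ M * ∏ u, (2 : ℝ)⁻¹ ^ d u := by
          refine Finset.sum_le_sum fun d hd => ?_
          rw [Finset.prod_pow_eq_pow_sum, inv_pow, ← div_eq_mul_inv, one_le_div (by positivity)]
          exact pow_le_pow_right₀ (by norm_num) (Finset.mem_filter.1 hd).2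
      _ ≤ ∑ d ∈ 𝒟, 2 ^ M * ∏ u, (2 : ℝ)⁻¹ ^ d u :=
          Finset.sum_le_sum_of_subset_of_nonneg (Finset.filter_subset _ _)
            fun _ _ _ => by positivity
      _ = 2 ^ M * ∏ u, ∑ t ∈ (if u ∈ U then Finset.range (M + 1) else {0}), (2 : ℝ)⁻¹ ^ t := by
          rw [← Finset.mul_sum, Finset.prod_univ_sum]
      _ ≤ 2 ^ M * ∏ u, (if u ∈ U then 2 else 1) := by
          gcongr
          exact hgeo _
      _ = 2 ^ (M + U.card) := by
          rw [Finset.prod_ite_mem, Finset.univ_inter, Finset.prod_const, pow_add]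
  exact_mod_cast h1

open Classical in
theorem card_bounded_codes_le {X : Type*} [Fintype X] (U : Finset X) (M K : ℕ) :
    (((Fintype.piFinset fun u : X => if u ∈ U then Finset.range (M + 1) else {0}).filter
      fun d => ∑ u, d u ≤ M).biUnion fun d =>
        Fintype.piFinset fun u => (Finset.range (K * d u)).powerset).card ≤
      2 ^ (M + U.card + K * M) := by
  refine Finset.card_biUnion_le.trans ?_
  refine (Finset.sum_le_card_nsmul _ _ (2 ^ (K * M)) fun d hd => ?_).trans ?_
  · rw [Fintype.card_piFinset]
    simp only [Finset.card_powerset, Finset.card_range]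
    rw [Finset.prod_pow_eq_pow_sum, ← Finset.mul_sum]
    exact Nat.pow_le_pow_right (by norm_num) (Nat.mul_le_mul_left _ (Finset.mem_filter.1 hd).2)
  · rw [smul_eq_mul, pow_add _ _ (K * M)]
    exact Nat.mul_le_mul_right _ (card_bounded_sum_le U M)

open Classical in
/-- The number of graphs with a prescribed independent set of low vertices, few high vertices, few
edges, and such that every end point of an edge has small rank in the order by decreasing degree,
compared with the degree of the other end point. -/
theorem card_graphs_le {X : Type*} [Fintype X] [Nonempty X] (𝒢 : Finset (SimpleGraph X))
    (L : Finset X) {D R K M : ℕ} (hL : ∀ G ∈ 𝒢, lowVerts G D = L)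
    (hind : ∀ G ∈ 𝒢, ∀ u ∈ lowVerts G D, ∀ v ∈ lowVerts G D, ¬ G.Adj u v)
    (hW : ∀ G ∈ 𝒢, (highVerts G D).card ≤ R) (hM : ∀ G ∈ 𝒢, ∑ u, G.degree u ≤ M)
    (hrank : ∀ G ∈ 𝒢, ∀ u v, G.Adj u v →
      (Finset.univ.filter fun w => G.degree v ≤ G.degree w).card ≤ K * G.degree u) :
    𝒢.card ≤ Fintype.card X ^ R * 2 ^ (M + (L.card + R) + K * M) := by
  choose! r hr using fun G : SimpleGraph X =>
    exists_enumeration_by_rank (highVerts G D) (fun u => G.degree u)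
  -- The code lists the high vertices by decreasing degree and records at each u the positions of
  -- its listed neighbours among the first K·d(u). Every edge has a high end, whose position the
  -- rank hypothesis bounds by K times the degree of the other end, so the code determines the
  -- graph.
  set code : SimpleGraph X → (Fin R → X) × (X → Finset ℕ) := fun G =>
    (fun k => r G k, fun u => (Finset.range (K * G.degree u)).filter fun k =>
      k < R ∧ G.Adj u (r G k)) with hcode
  have hdec : ∀ G ∈ 𝒢, ∀ u v, G.Adj u v ↔
      (∃ k : Fin R, (k : ℕ) ∈ (code G).2 u ∧ (code G).1 k = v) ∨
      (∃ k : Fin R, (k : ℕ) ∈ (code G).2 v ∧ (code G).1 k = u) := by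
    intro G hG u v
    have hone : ∀ u v, G.Adj u v → v ∈ highVerts G D →
        ∃ k : Fin R, (k : ℕ) ∈ (code G).2 u ∧ (code G).1 k = v := by
      intro u v huv hv
      obtain ⟨k, hk, hkv⟩ := hr G v hv
      have hkR : k < R := hk.trans_le ((Finset.card_filter_le _ _).trans (hW G hG))
      refine ⟨⟨k, hkR⟩, ?_, hkv⟩
      simp only [hcode, Finset.mem_filter, Finset.mem_range]
      refine ⟨?_, hkR, by rw [hkv]; exact huv⟩
      refine hk.trans_le (le_trans (Finset.card_le_card fun w hw => ?_) (hrank G hG u v huv))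
      exact Finset.mem_filter.2 ⟨Finset.mem_univ _, (Finset.mem_filter.1 hw).2⟩
    constructor
    · intro huv
      rcases mem_lowVerts_or_mem_highVerts D huv with h | h
      · rcases mem_lowVerts_or_mem_highVerts D huv.symm with h' | h'
        · exact absurd huv (hind G hG u h v h')
        · exact Or.inl (hone u v huv h')
      · exact Or.inr (hone v u huv.symm h)
    · rintro (⟨k, hk, rfl⟩ | ⟨k, hk, rfl⟩)
      · exact (Finset.mem_filter.1 hk).2.2
      · exact (Finset.mem_filter.1 hk).2.2.symm
  have hinj : Set.InjOn code (𝒢 : Set (SimpleGraph X)) := by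
    intro G hG G' hG' h
    ext u v
    rw [hdec G hG, hdec G' hG', h]
  set T : Finset ((Fin R → X) × (X → Finset ℕ)) := Finset.univ.biUnion fun ρ : Fin R → X =>
    (((Fintype.piFinset fun u : X => if u ∈ L ∪ Finset.univ.image ρ then Finset.range (M + 1)
      else {0}).filter fun d => ∑ u, d u ≤ M).biUnion fun d =>
        Fintype.piFinset fun u => (Finset.range (K * d u)).powerset).image fun S => (ρ, S) with hT
  have hmaps : ∀ G ∈ 𝒢, code G ∈ T := by
    intro G hG
    refine Finset.mem_biUnion.2 ⟨(code G).1, Finset.mem_univ _,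
      Finset.mem_image.2 ⟨(code G).2, Finset.mem_biUnion.2 ⟨fun u => G.degree u, ?_, ?_⟩, rfl⟩⟩
    · refine Finset.mem_filter.2 ⟨Fintype.mem_piFinset.2 fun u => ?_, hM G hG⟩
      split_ifs with hu
      · refine Finset.mem_range.2 (Nat.lt_succ_of_le (le_trans ?_ (hM G hG)))
        exact Finset.single_le_sum (f := fun u => G.degree u) (fun _ _ => Nat.zero_le _)
          (Finset.mem_univ u)
      · rw [Finset.mem_singleton]
        by_contra h0
        obtain ⟨v, hv⟩ := (G.degree_pos_iff_exists_adj u).1 (Nat.pos_of_ne_zero h0)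
        refine hu (Finset.mem_union.2 ?_)
        rcases mem_lowVerts_or_mem_highVerts D hv with h | h
        · exact Or.inl (hL G hG ▸ h)
        · obtain ⟨k, hk, hku⟩ := hr G u h
          have hkR : k < R := hk.trans_le ((Finset.card_filter_le _ _).trans (hW G hG))
          exact Or.inr (Finset.mem_image.2 ⟨⟨k, hkR⟩, Finset.mem_univ _, hku⟩)
    · exact Fintype.mem_piFinset.2 fun u => Finset.mem_powerset.2 (Finset.filter_subset _ _)
  refine (Finset.card_le_card_of_injOn code hmaps hinj).trans ?_
  refine Finset.card_biUnion_le.trans ?_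
  refine (Finset.sum_le_card_nsmul _ _ (2 ^ (M + (L.card + R) + K * M)) fun ρ _ => ?_).trans ?_
  · refine Finset.card_image_le.trans ((card_bounded_codes_le _ M K).trans ?_)
    refine Nat.pow_le_pow_right (by norm_num) ?_
    have h1 := Finset.card_union_le L (Finset.univ.image ρ)
    have h2 : (Finset.univ.image ρ).card ≤ R :=
      Finset.card_image_le.trans (by rw [Finset.card_univ, Fintype.card_fin])
    omega
  · rw [Finset.card_univ, Fintype.card_fun, Fintype.card_fin, smul_eq_mul]

open Classical in
theorem card_lowVerts_le_sum_degree {X : Type*} [Fintype X] (G : SimpleGraph X) (D : ℕ) :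
    (lowVerts G D).card ≤ ∑ u, G.degree u := by
  rw [Finset.card_eq_sum_ones]
  exact (Finset.sum_le_sum fun u hu => (mem_lowVerts.1 hu).1).trans
    (Finset.sum_le_sum_of_subset (Finset.subset_univ _))

open Classical in
/-- The generating function of the number of low vertices over a class of graphs as in
`card_graphs_le`. -/
theorem sum_pow_card_lowVerts_le {X : Type*} [Fintype X] [Nonempty X] (𝒢 : Finset (SimpleGraph X))
    {D R K M : ℕ} (hind : ∀ G ∈ 𝒢, ∀ u ∈ lowVerts G D, ∀ v ∈ lowVerts G D, ¬ G.Adj u v)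
    (hW : ∀ G ∈ 𝒢, (highVerts G D).card ≤ R) (hM : ∀ G ∈ 𝒢, ∑ u, G.degree u ≤ M) (hR : R ≤ M)
    (hrank : ∀ G ∈ 𝒢, ∀ u v, G.Adj u v →
      (Finset.univ.filter fun w => G.degree v ≤ G.degree w).card ≤ K * G.degree u)
    {q : ℝ} (hq : 0 ≤ q) :
    ∑ G ∈ 𝒢, q ^ (lowVerts G D).card ≤
      (Fintype.card X : ℝ) ^ R * 2 ^ ((K + 3) * M) * (q + 1) ^ Fintype.card X := by
  rw [← Finset.sum_fiberwise_of_maps_to (s := 𝒢) (t := (Finset.univ : Finset X).powerset)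
    (g := fun G => lowVerts G D) fun G _ => Finset.mem_powerset.2 (Finset.subset_univ _)]
  have hfib : ∀ L ∈ (Finset.univ : Finset X).powerset,
      ∑ G ∈ 𝒢.filter fun G => lowVerts G D = L, q ^ (lowVerts G D).card ≤
        (Fintype.card X : ℝ) ^ R * 2 ^ ((K + 3) * M) * q ^ L.card := by
    intro L _
    have h1 : ∑ G ∈ 𝒢.filter fun G => lowVerts G D = L, q ^ (lowVerts G D).card =
        ((𝒢.filter fun G => lowVerts G D = L).card : ℝ) * q ^ L.card := by
      rw [← nsmul_eq_mul, ← Finset.sum_const]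
      exact Finset.sum_congr rfl fun G hG => by rw [(Finset.mem_filter.1 hG).2]
    rw [h1]
    refine mul_le_mul_of_nonneg_right ?_ (by positivity)
    rcases (𝒢.filter fun G => lowVerts G D = L).eq_empty_or_nonempty with h0 | ⟨G₀, hG₀⟩
    · rw [h0, Finset.card_empty, Nat.cast_zero]
      positivity
    have hmem : ∀ G ∈ 𝒢.filter fun G => lowVerts G D = L, G ∈ 𝒢 :=
      fun G hG => (Finset.mem_filter.1 hG).1
    have hLM : L.card ≤ M := by
      rw [← (Finset.mem_filter.1 hG₀).2]
      exact (card_lowVerts_le_sum_degree G₀ D).trans (hM G₀ (hmem G₀ hG₀))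
    have h2 := card_graphs_le (𝒢.filter fun G => lowVerts G D = L) L (D := D) (R := R) (K := K)
      (M := M) (fun G hG => (Finset.mem_filter.1 hG).2) (fun G hG => hind G (hmem G hG))
      (fun G hG => hW G (hmem G hG)) (fun G hG => hM G (hmem G hG))
      (fun G hG => hrank G (hmem G hG))
    have h3 : Fintype.card X ^ R * 2 ^ (M + (L.card + R) + K * M) ≤
        Fintype.card X ^ R * 2 ^ ((K + 3) * M) := by
      refine Nat.mul_le_mul_left _ (Nat.pow_le_pow_right (by norm_num) ?_)
      have : (K + 3) * M = K * M + 3 * M := by ring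
      omega
    exact_mod_cast h2.trans h3
  refine (Finset.sum_le_sum hfib).trans (le_of_eq ?_)
  rw [← Finset.mul_sum]
  congr 1
  have := Finset.sum_pow_mul_eq_add_pow q 1 (Finset.univ : Finset X)
  simpa using this

/-! ### Structure of strong-core graphs -/

-- Some vertex of `H` is sent to `u`, and its Δ neighbours go to distinct neighbours of `u`.
open Classical in
theorem le_degree_of_labelledCopyCountThrough_pos {V X : Type*} [Fintype V] [Fintype X]
    (H : SimpleGraph V) {Δ : ℕ} (hreg : ∀ a, H.degree a = Δ) (G : SimpleGraph X) {u v : X}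
    (h : 0 < labelledCopyCountThrough G H s(u, v)) : Δ ≤ G.degree u := by
  obtain ⟨d, _, hd⟩ := Finset.exists_ne_zero_of_sum_ne_zero
    (h.trans_le (labelledCopyCountThrough_le H G u v)).ne'
  obtain ⟨φ, hφ⟩ := Finset.card_pos.1 (Nat.pos_of_ne_zero hd)
  obtain ⟨hφc, rfl, _⟩ := Finset.mem_filter.1 hφ
  obtain ⟨hinj, hadj⟩ := mem_copyMaps.1 hφc
  rw [← hreg d.fst, ← H.card_neighborFinset_eq_degree, ← G.card_neighborFinset_eq_degree]
  refine Finset.card_le_card_of_injOn φ (fun b hb => ?_) hinj.injOn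
  exact Finset.mem_coe.2 ((G.mem_neighborFinset _ _).2
    (hadj _ _ ((H.mem_neighborFinset _ _).1 (Finset.mem_coe.1 hb))))

open Classical in
theorem mul_card_lowVerts_le_sum_degree {X : Type*} [Fintype X] (G : SimpleGraph X) {Δ : ℕ} (D : ℕ)
    (hdeg : ∀ u v, G.Adj u v → Δ ≤ G.degree u) :
    Δ * (lowVerts G D).card ≤ ∑ u, G.degree u := by
  rw [mul_comm, ← smul_eq_mul]
  refine (Finset.card_nsmul_le_sum (lowVerts G D) (fun u => G.degree u) Δ fun u hu => ?_).trans
    (Finset.sum_le_sum_of_subset (Finset.subset_univ _))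
  obtain ⟨w, hw⟩ := (G.degree_pos_iff_exists_adj u).1 (mem_lowVerts.1 hu).1
  exact hdeg u w hw

open Classical in
/-- The structure of strong-core graphs: the ends of an edge have small rank compared with the
degree of the other end, and at one of boundedly many scales the number of edges is large even when
discounted by the number of low vertices. -/
theorem exists_scale_of_strongCore {V : Type*} [Fintype V] (H : SimpleGraph V) {Δ : ℕ}
    (hΔ : 2 ≤ Δ) (hreg : ∀ a, H.degree a = Δ) (hconn : H.Connected) {δ ε C : ℝ} (hδ : 0 < δ)
    (hε : 0 < ε) (hε7 : ε < 1 / 7) (hC : 0 < C) {D₀ : ℕ} (hD₀ : 0 < D₀) :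
    ∃ (J K : ℕ) (D : ℕ → ℕ) (x₀ : ℝ), 0 < J ∧ (∀ j, D₀ ≤ D j) ∧ ∀ (X : Type) [Fintype X]
      (G : SimpleGraph X) (x : ℝ), 0 < x → x₀ ≤ x → ((∑ u, G.degree u : ℕ) : ℝ) ≤ C * x ^ 2 →
      δ * (1 - 6 * ε) * x ^ Fintype.card V ≤ (G.labelledCopyCount H : ℝ) →
      (∀ u v, G.Adj u v → δ * ε / (C / 2) * x ^ (Fintype.card V - 2) ≤
        (labelledCopyCountThrough G H s(u, v) : ℝ)) →
      (∀ u v, G.Adj u v →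
        (Finset.univ.filter fun w => G.degree v ≤ G.degree w).card ≤ K * G.degree u) ∧
      ∃ j < J, (∀ u ∈ lowVerts G (D j), ∀ v ∈ lowVerts G (D j), ¬ G.Adj u v) ∧
        δ ^ ((2 : ℝ) / Fintype.card V) * (1 - 7 * ε) * x ^ 2 ≤
          ((∑ u, G.degree u : ℕ) : ℝ) - Δ * (lowVerts G (D j)).card := by
  have hne : Nonempty V := hconn.nonempty
  have hV : 2 ≤ Fintype.card V := by
    obtain ⟨a⟩ := hne
    obtain ⟨b, hb⟩ := (H.degree_pos_iff_exists_adj a).1 (by rw [hreg]; omega)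
    exact Fintype.one_lt_card_iff.2 ⟨a, b, hb.ne⟩
  obtain ⟨c, hc, hdd⟩ := exists_le_degree_mul_degree H hΔ hreg hV
    (c₀ := δ * ε / (C / 2)) (C := C) (by positivity) hC
  -- Taking κ = δε turns the factor 1 − 6ε of the definition into 1 − 7ε.
  obtain ⟨J, D, x₀, hJ, hD, hscale⟩ := exists_scale_card_copyMaps_le H hΔ hreg hconn hc hC
    (mul_pos hδ hε) hD₀
  obtain ⟨K, hK⟩ := exists_nat_ge (C / c)
  refine ⟨J, K, D, x₀, hJ, hD, fun X _ G x hx hx₀ hM hcop hthr => ?_⟩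
  have hedge : ∀ u v, G.Adj u v → c * x ^ 2 ≤ (G.degree u : ℝ) * G.degree v :=
    fun u v huv => hdd X G x hx hM u v huv (hthr u v huv)
  have hdeg : ∀ u v, G.Adj u v → Δ ≤ G.degree u := fun u v huv => by
    refine le_degree_of_labelledCopyCountThrough_pos H hreg G (v := v) ?_
    have : (0 : ℝ) < labelledCopyCountThrough G H s(u, v) :=
      lt_of_lt_of_le (by positivity) (hthr u v huv)
    exact_mod_cast this
  refine ⟨fun u v huv => ?_, ?_⟩
  -- The rank N of v satisfies N·d(v) ≤ Cx², while cx² ≤ d(u)d(v), so N ≤ (C/c)d(u).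
  · have h1 := card_mul_le_sum_degree G (Finset.univ.filter fun w => G.degree v ≤ G.degree w)
      (t := G.degree v) fun w hw => by exact_mod_cast (Finset.mem_filter.1 hw).2
    set N := (Finset.univ.filter fun w => G.degree v ≤ G.degree w).card
    have h2 : (N : ℝ) * (c * x ^ 2) ≤ C * x ^ 2 * G.degree u := by
      calc (N : ℝ) * (c * x ^ 2) ≤ N * (G.degree u * G.degree v) :=
            mul_le_mul_of_nonneg_left (hedge u v huv) (Nat.cast_nonneg _)
        _ = N * G.degree v * G.degree u := by ring
        _ ≤ C * x ^ 2 * G.degree u :=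
            mul_le_mul_of_nonneg_right (h1.trans hM) (Nat.cast_nonneg _)
    have h3 : (N : ℝ) ≤ C / c * G.degree u := by
      have hx2 : 0 < x ^ 2 := by positivity
      rw [div_mul_eq_mul_div, le_div_iff₀ hc]
      refine le_of_mul_le_mul_right (a := x ^ 2) ?_ hx2
      linarith
    have h4 : (N : ℝ) ≤ K * G.degree u :=
      h3.trans (mul_le_mul_of_nonneg_right hK (Nat.cast_nonneg _))
    exact_mod_cast h4
  · obtain ⟨j, hj, hind, hN⟩ := hscale X G x hx hx₀ hM hedge hdeg
    refine ⟨j, hj, hind, ?_⟩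
    set Y : ℝ := ((∑ u, G.degree u : ℕ) : ℝ) - Δ * (lowVerts G (D j)).card with hY
    have hY0 : 0 ≤ Y := by
      have : ((Δ * (lowVerts G (D j)).card : ℕ) : ℝ) ≤ ((∑ u, G.degree u : ℕ) : ℝ) :=
        Nat.cast_le.2 (mul_card_lowVerts_le_sum_degree G (D j) hdeg)
      rw [Nat.cast_mul] at this
      linarith
    have hcop' : (G.labelledCopyCount H : ℝ) ≤ (copyMaps H G).card :=
      Nat.cast_le.2 (labelledCopyCount_le_card_copyMaps H G)
    have h1 : δ * (1 - 7 * ε) * x ^ Fintype.card V ≤ Y ^ ((Fintype.card V : ℝ) / 2) := by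
      have : δ * (1 - 7 * ε) * x ^ Fintype.card V =
        δ * (1 - 6 * ε) * x ^ Fintype.card V - δ * ε * x ^ Fintype.card V := by ring
      linarith
    have hvr : (2 : ℝ) ≤ Fintype.card V := by exact_mod_cast hV
    have hv0 : (0 : ℝ) < Fintype.card V := by linarith
    have h7 : 0 < 1 - 7 * ε := by linarith
    have h2 := Real.rpow_le_rpow (z := 2 / (Fintype.card V : ℝ)) (by positivity) h1 (by positivity)
    rw [← Real.rpow_mul hY0, div_mul_div_cancel₀ (by norm_num), div_self hv0.ne', Real.rpow_one,
      Real.mul_rpow (by positivity) (by positivity), Real.mul_rpow hδ.le h7.le,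
      ← Real.rpow_natCast_mul hx.le, mul_div_cancel₀ _ hv0.ne', Real.rpow_two] at h2
    refine le_trans ?_ h2
    have h3 : 1 - 7 * ε ≤ (1 - 7 * ε) ^ (2 / (Fintype.card V : ℝ)) := by
      nth_rw 1 [← Real.rpow_one (1 - 7 * ε)]
      refine Real.rpow_le_rpow_of_exponent_ge h7 (by linarith) ?_
      rw [div_le_one hv0]
      exact hvr
    gcongr

/-! ### Union bound and asymptotics -/

open Classical MeasureTheory ProbabilityTheory in
/-- The probability that the binomial random graph contains a given graph. -/
theorem binomialRandom_setOf_ge_le {X : Type*} [Fintype X] (p : unitInterval) (G : SimpleGraph X) :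
    SimpleGraph.binomialRandom X p {G' | G ≤ G'} ≤
      ENNReal.ofReal ((p : ℝ) ^ G.edgeSet.ncard) := by
  have hsub : SimpleGraph.edgeSet '' {G' : SimpleGraph X | G ≤ G'} ⊆ {S | G.edgeSet ⊆ S} := by
    rintro _ ⟨G', h, rfl⟩
    exact SimpleGraph.edgeSet_subset_edgeSet.2 h
  rw [SimpleGraph.binomialRandom_apply']
  refine (measure_mono hsub).trans ?_
  rw [setBernoulli_apply']
  have hpi : (fun q : Sym2 X → Prop => {i | q i}) ⁻¹' {S | G.edgeSet ⊆ S} =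
      Set.pi (G.edgeSet.toFinset : Set (Sym2 X)) fun _ => {True} := by
    ext q
    simp [Set.subset_def, Set.mem_pi]
  rw [hpi, Measure.infinitePi_pi _ fun _ _ => MeasurableSet.singleton _,
    Set.ncard_eq_toFinset_card', ENNReal.ofReal_pow p.2.1, ← Finset.prod_const]
  refine Finset.prod_le_prod' fun e he => ?_
  have h1 : ({True} : Set Prop).indicator (1 : Prop → ENNReal) False = 0 := by simp
  simp only [Measure.add_apply, Measure.smul_apply, MeasurableSet.singleton, Measure.dirac_apply',
    h1, ENNReal.smul_def, smul_eq_mul, mul_zero, add_zero]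
  rw [← unitInterval.coe_toNNReal, ENNReal.ofReal_coe_nnreal]
  exact mul_le_of_le_one_right' (Set.indicator_le_self' (fun _ _ => zero_le) _)

open Classical in
theorem strongCoreProb_le_sum {V : Type*} [Fintype V] (H : SimpleGraph V) (Δ : ℕ) (δ ε C : ℝ)
    (n : ℕ) (p : unitInterval) :
    strongCoreProb H Δ δ ε C n p ≤ ENNReal.ofReal
      (∑ G ∈ Finset.univ.filter fun G : SimpleGraph (Fin n) => IsStrongCore H Δ δ ε C n (p : ℝ) G,
        (p : ℝ) ^ G.edgeSet.ncard) := by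
  unfold strongCoreProb
  rw [ENNReal.ofReal_sum_of_nonneg fun _ _ => pow_nonneg p.2.1 _]
  have hsub : {G' : SimpleGraph (Fin n) | ∃ G ≤ G', IsStrongCore H Δ δ ε C n (p : ℝ) G} ⊆
      ⋃ G ∈ Finset.univ.filter fun G : SimpleGraph (Fin n) => IsStrongCore H Δ δ ε C n (p : ℝ) G,
        {G' | G ≤ G'} := by
    rintro G' ⟨G, hle, hG⟩
    simp only [Set.mem_iUnion]
    exact ⟨G, Finset.mem_filter.2 ⟨Finset.mem_univ _, hG⟩, hle⟩
  refine (MeasureTheory.measure_mono hsub).trans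
    ((MeasureTheory.measure_biUnion_finset_le _ _).trans ?_)
  exact Finset.sum_le_sum fun G _ => binomialRandom_setOf_ge_le p G

open Classical in
/-- A union bound over graphs with a discount for the low vertices at one of several scales. -/
theorem sum_pow_edges_le {X : Type*} [Fintype X] [Nonempty X] (𝒮 : Finset (SimpleGraph X))
    {p : ℝ} (hp0 : 0 < p) (hp1 : p < 1) (Δ : ℕ) {J R K M : ℕ} (D : ℕ → ℕ) {τ : ℝ} (hR : R ≤ M)
    (hM : ∀ G ∈ 𝒮, ∑ u, G.degree u ≤ M) (hW : ∀ G ∈ 𝒮, ∀ j, (highVerts G (D j)).card ≤ R)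
    (hrank : ∀ G ∈ 𝒮, ∀ u v, G.Adj u v →
      (Finset.univ.filter fun w => G.degree v ≤ G.degree w).card ≤ K * G.degree u)
    (hscale : ∀ G ∈ 𝒮, ∃ j < J, (∀ u ∈ lowVerts G (D j), ∀ v ∈ lowVerts G (D j), ¬ G.Adj u v) ∧
      τ ≤ ((∑ u, G.degree u : ℕ) : ℝ) - Δ * (lowVerts G (D j)).card) :
    ∑ G ∈ 𝒮, p ^ G.edgeSet.ncard ≤ p ^ (τ / 2) * (J * ((Fintype.card X : ℝ) ^ R *
      2 ^ ((K + 3) * M) * (p ^ ((Δ : ℝ) / 2) + 1) ^ Fintype.card X)) := by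
  set q : ℝ := p ^ ((Δ : ℝ) / 2) with hq
  have hq0 : 0 < q := Real.rpow_pos_of_pos hp0 _
  set good : ℕ → SimpleGraph X → Prop := fun j G =>
    (∀ u ∈ lowVerts G (D j), ∀ v ∈ lowVerts G (D j), ¬ G.Adj u v) ∧
      τ ≤ ((∑ u, G.degree u : ℕ) : ℝ) - Δ * (lowVerts G (D j)).card with hgood
  have hedges : ∀ G : SimpleGraph X, p ^ G.edgeSet.ncard =
      p ^ (((∑ u, G.degree u : ℕ) : ℝ) / 2) := fun G => by
    rw [G.sum_degrees_eq_twice_card_edges, ← SimpleGraph.coe_edgeFinset, Set.ncard_coe_finset,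
      ← Real.rpow_natCast]
    congr 1
    push_cast
    ring
  -- Since 2e(G) ≥ τ + Δ|L|, each low vertex contributes its own factor q = p^{Δ/2}.
  have hone : ∀ G j, good j G → p ^ G.edgeSet.ncard ≤
      p ^ (τ / 2) * q ^ (lowVerts G (D j)).card := by
    intro G j hG
    rw [hedges, hq, ← Real.rpow_mul_natCast hp0.le, ← Real.rpow_add hp0]
    refine Real.rpow_le_rpow_of_exponent_ge hp0 hp1.le ?_
    linarith [hG.2]
  calc ∑ G ∈ 𝒮, p ^ G.edgeSet.ncard
      ≤ ∑ G ∈ 𝒮, ∑ j ∈ Finset.range J, if good j G then p ^ G.edgeSet.ncard else 0 := by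
        refine Finset.sum_le_sum fun G hG => ?_
        obtain ⟨j, hj, h⟩ := hscale G hG
        refine le_trans (le_of_eq (if_pos h).symm) (Finset.single_le_sum
          (f := fun j => if good j G then p ^ G.edgeSet.ncard else 0) (fun i _ => ?_)
          (Finset.mem_range.2 hj))
        positivity
    _ = ∑ j ∈ Finset.range J, ∑ G ∈ 𝒮.filter (good j), p ^ G.edgeSet.ncard := by
        rw [Finset.sum_comm]
        simp only [Finset.sum_filter]
    _ ≤ ∑ j ∈ Finset.range J, p ^ (τ / 2) * ((Fintype.card X : ℝ) ^ R *
          2 ^ ((K + 3) * M) * (q + 1) ^ Fintype.card X) := by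
        refine Finset.sum_le_sum fun j _ => ?_
        have hmem : ∀ G ∈ 𝒮.filter (good j), G ∈ 𝒮 := fun G hG => (Finset.mem_filter.1 hG).1
        have h := sum_pow_card_lowVerts_le (𝒮.filter (good j)) (D := D j) (R := R) (K := K) (M := M)
          (fun G hG => (Finset.mem_filter.1 hG).2.1) (fun G hG => hW G (hmem G hG) j)
          (fun G hG => hM G (hmem G hG)) hR (fun G hG => hrank G (hmem G hG)) hq0.le
        refine le_trans ?_ (mul_le_mul_of_nonneg_left h (by positivity))
        rw [Finset.mul_sum]
        exact Finset.sum_le_sum fun G hG => hone G j (Finset.mem_filter.1 hG).2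
    _ = _ := by
        rw [Finset.sum_const, Finset.card_range, nsmul_eq_mul]
        ring

open Classical in
theorem two_mul_ncard_edgeSet {X : Type*} [Fintype X] (G : SimpleGraph X) :
    2 * G.edgeSet.ncard = ∑ u, G.degree u := by
  rw [G.sum_degrees_eq_twice_card_edges, ← SimpleGraph.coe_edgeFinset, Set.ncard_coe_finset]

open Classical in
/-- The quantitative upper bound for the probability of containing a strong-core graph. -/
theorem exists_strongCoreProb_le {V : Type*} [Fintype V] (H : SimpleGraph V) {Δ : ℕ}
    (hΔ : 2 ≤ Δ) (hreg : ∀ a, H.degree a = Δ) (hconn : H.Connected) {δ ε C : ℝ} (hδ : 0 < δ)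
    (hε : 0 < ε) (hε7 : ε < 1 / 7) (hC : 0 < C) :
    ∃ x₀ A : ℝ, ∀ (n : ℕ) (p : unitInterval), 0 < n → 0 < (p : ℝ) → (p : ℝ) < 1 →
      x₀ ≤ n * (p : ℝ) ^ ((Δ : ℝ) / 2) → 1 ≤ n * (p : ℝ) ^ ((Δ : ℝ) / 2) →
      A ≤ Real.log (1 / (p : ℝ)) → Real.log n ≤ Δ * Real.log (1 / (p : ℝ)) →
      strongCoreProb H Δ δ ε C n p ≤ ENNReal.ofReal (Real.exp
        (-((1 / 2 * δ ^ ((2 : ℝ) / Fintype.card V) * (1 - 8 * ε)) *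
          ((n : ℝ) ^ 2 * (p : ℝ) ^ Δ * Real.log (1 / (p : ℝ)))))) := by
  set θ : ℝ := 1 / 2 * δ ^ ((2 : ℝ) / Fintype.card V) * ε with hθ
  have hθ0 : 0 < θ := by positivity
  have hΔr : (0 : ℝ) < Δ := by exact_mod_cast (by omega : 0 < Δ)
  -- All scales exceed `D₀`, so there are at most 2Cx²/D₀ high vertices. This choice makes n^R cost
  -- at most half of the slack θx² log(1/p); the terms exp(O(x²)) use the other half through `A`.
  obtain ⟨D₀, hD₀⟩ := exists_nat_gt (2 * (2 * C) * Δ / θ)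
  have hD₀r : (0 : ℝ) < D₀ := lt_trans (by positivity) hD₀
  have hD₀' : 0 < D₀ := by exact_mod_cast hD₀r
  obtain ⟨J, K, D, x₀, hJ, hD, hmain⟩ := exists_scale_of_strongCore H hΔ hreg hconn hδ hε hε7
    (C := 2 * C) (by positivity) hD₀'
  refine ⟨x₀, 2 * (J + 1 + (K + 3) * (2 * C)) / θ, fun n p hn hp0 hp1 hx₀ hx1 hA hlog => ?_⟩
  have : Nonempty (Fin n) := ⟨⟨0, hn⟩⟩
  have hnr : (0 : ℝ) < n := by exact_mod_cast hn
  set P : ℝ := (p : ℝ) with hP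
  set q : ℝ := P ^ ((Δ : ℝ) / 2) with hq
  set x : ℝ := n * q with hx
  set lp : ℝ := Real.log (1 / P) with hlp
  have hq0 : 0 < q := Real.rpow_pos_of_pos hp0 _
  have hx0 : 0 < x := by positivity
  have hlp0 : 0 < lp := Real.log_pos (by rw [lt_div_iff₀ hp0]; linarith)
  have hqΔ : q ^ 2 = P ^ Δ := by
    rw [hq, ← Real.rpow_mul_natCast hp0.le, ← Real.rpow_natCast]
    congr 1
    push_cast
    ring
  have hx2 : x ^ 2 = (n : ℝ) ^ 2 * P ^ Δ := by rw [hx, mul_pow, hqΔ]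
  have hqv : q ^ Fintype.card V = P ^ H.edgeSet.ncard := by
    have h1 := two_mul_ncard_edgeSet H
    simp only [hreg, Finset.sum_const, Finset.card_univ, smul_eq_mul] at h1
    have h2 : (2 : ℝ) * H.edgeSet.ncard = Fintype.card V * Δ := by exact_mod_cast h1
    rw [hq, ← Real.rpow_mul_natCast hp0.le, ← Real.rpow_natCast]
    congr 1
    linarith
  set M : ℕ := ⌊2 * C * x ^ 2⌋₊ with hM
  set R : ℕ := ⌊2 * C * x ^ 2 / D₀⌋₊ with hR
  have hMle : (M : ℝ) ≤ 2 * C * x ^ 2 := Nat.floor_le (by positivity)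
  have hRle : (R : ℝ) ≤ 2 * C * x ^ 2 / D₀ := Nat.floor_le (by positivity)
  have hRM : R ≤ M := Nat.floor_le_floor (div_le_self (by positivity) (by exact_mod_cast hD₀'))
  set 𝒮 := Finset.univ.filter fun G : SimpleGraph (Fin n) => IsStrongCore H Δ δ ε C n P G with h𝒮
  have hdegsum : ∀ G ∈ 𝒮, ((∑ u, G.degree u : ℕ) : ℝ) ≤ 2 * C * x ^ 2 := fun G hG => by
    have h := (Finset.mem_filter.1 hG).2.edges
    rw [← two_mul_ncard_edgeSet, hx2]
    push_cast
    linarith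
  have hstr := fun G (hG : G ∈ 𝒮) => hmain (Fin n) G x hx0 hx₀ (hdegsum G hG)
    (by
      have h := (Finset.mem_filter.1 hG).2.copies
      rw [hx, mul_pow, hqv, ← mul_assoc]
      exact h)
    (fun u v huv => by
      have h := (Finset.mem_filter.1 hG).2.copies_through s(u, v) huv
      rw [mul_div_cancel_left₀ C two_ne_zero]
      exact h)
  have hsum := sum_pow_edges_le 𝒮 hp0 hp1 Δ (J := J) (R := R) (K := K) (M := M) D
    (τ := δ ^ ((2 : ℝ) / Fintype.card V) * (1 - 7 * ε) * x ^ 2) hRM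
    (fun G hG => Nat.le_floor (hdegsum G hG))
    (fun G hG j => Nat.le_floor (by
      have h := card_mul_le_sum_degree G (highVerts G (D j)) (t := D₀) fun u hu => by
        exact_mod_cast (hD j).trans (mem_highVerts.1 hu).le
      rw [le_div_iff₀ hD₀r]
      exact h.trans (hdegsum G hG)))
    (fun G hG => (hstr G hG).1) (fun G hG => (hstr G hG).2)
  refine (strongCoreProb_le_sum H Δ δ ε C n p).trans (ENNReal.ofReal_le_ofReal (hsum.trans ?_))
  rw [Fintype.card_fin]
  have e1 : P ^ (δ ^ ((2 : ℝ) / Fintype.card V) * (1 - 7 * ε) * x ^ 2 / 2) =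
      Real.exp (-(δ ^ ((2 : ℝ) / Fintype.card V) * (1 - 7 * ε) * x ^ 2 / 2 * lp)) := by
    rw [Real.rpow_def_of_pos hp0, hlp, one_div, Real.log_inv]
    congr 1
    ring
  have hx21 : 1 ≤ x ^ 2 := one_le_pow₀ hx1
  have e2 : (J : ℝ) ≤ Real.exp (J * x ^ 2) := by
    have h1 := Real.add_one_le_exp (J * x ^ 2)
    have h2 : (J : ℝ) ≤ J * x ^ 2 := le_mul_of_one_le_right (Nat.cast_nonneg _) hx21
    linarith
  have e3 : (n : ℝ) ^ R ≤ Real.exp (θ / 2 * x ^ 2 * lp) := by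
    rw [← Real.exp_log hnr, ← Real.exp_nat_mul]
    refine Real.exp_le_exp.2 ?_
    calc (R : ℝ) * Real.log n ≤ 2 * C * x ^ 2 / D₀ * (Δ * lp) := by
          refine mul_le_mul hRle hlog (Real.log_natCast_nonneg n) (by positivity)
      _ = 2 * C * Δ / D₀ * (x ^ 2 * lp) := by ring
      _ ≤ θ / 2 * (x ^ 2 * lp) := by
          refine mul_le_mul_of_nonneg_right ?_ (by positivity)
          rw [div_lt_iff₀ hθ0] at hD₀
          rw [div_le_iff₀ hD₀r]
          linarith
      _ = _ := by ring
  have e4 : (2 : ℝ) ^ ((K + 3) * M) ≤ Real.exp ((K + 3) * (2 * C) * x ^ 2) := by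
    have h1 : (2 : ℝ) ≤ Real.exp 1 := by
      have := Real.add_one_le_exp 1
      linarith
    refine (pow_le_pow_left₀ (by norm_num) h1 _).trans ?_
    rw [← Real.exp_nat_mul]
    refine Real.exp_le_exp.2 ?_
    push_cast
    have h2 := mul_le_mul_of_nonneg_left hMle (show (0 : ℝ) ≤ K + 3 by positivity)
    linarith
  -- (1+q)^n ≤ e^{nq} = e^x, and x ≤ x² because x ≥ 1.
  have e5 : (q + 1) ^ n ≤ Real.exp (x ^ 2) := by
    refine (pow_le_pow_left₀ (by positivity) (Real.add_one_le_exp q) n).trans ?_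
    rw [← Real.exp_nat_mul]
    refine Real.exp_le_exp.2 ?_
    nlinarith
  rw [e1]
  calc Real.exp (-(δ ^ ((2 : ℝ) / Fintype.card V) * (1 - 7 * ε) * x ^ 2 / 2 * lp)) *
        (J * ((n : ℝ) ^ R * 2 ^ ((K + 3) * M) * (q + 1) ^ n))
      ≤ Real.exp (-(δ ^ ((2 : ℝ) / Fintype.card V) * (1 - 7 * ε) * x ^ 2 / 2 * lp)) *
        (Real.exp (J * x ^ 2) * (Real.exp (θ / 2 * x ^ 2 * lp) *
          Real.exp ((K + 3) * (2 * C) * x ^ 2) * Real.exp (x ^ 2))) := by gcongr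
    _ ≤ _ := by
        rw [← Real.exp_add, ← Real.exp_add, ← Real.exp_add, ← Real.exp_add]
        refine Real.exp_le_exp.2 ?_
        rw [← hx2]
        rw [div_le_iff₀ hθ0] at hA
        have h1 : (J + 1 + (K + 3) * (2 * C)) * x ^ 2 ≤ θ / 2 * lp * x ^ 2 := by
          refine mul_le_mul_of_nonneg_right ?_ (by positivity)
          linarith
        have h2 : 1 / 2 * δ ^ ((2 : ℝ) / Fintype.card V) * (1 - 8 * ε) * (x ^ 2 * lp) =
            δ ^ ((2 : ℝ) / Fintype.card V) * (1 - 7 * ε) * x ^ 2 / 2 * lp - θ * (x ^ 2 * lp) := by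
          rw [hθ]
          ring
        rw [h2]
        linarith

theorem mainTheorem4 {V : Type*} [Fintype V] (H : SimpleGraph V) [H.LocallyFinite] (Δ : ℕ)
    (hΔ : 2 ≤ Δ) (hreg : H.IsRegularOfDegree Δ) (hconn : H.Connected) :
    ∃ f : ℝ → ℝ, (∀ ε, 0 ≤ f ε) ∧
      Filter.Tendsto f (nhdsWithin 0 (Set.Ioi 0)) (nhds 0) ∧
      ∃ ε₀ : ℝ, 0 < ε₀ ∧ ∀ δ : ℝ, 0 < δ → ∀ C : ℝ, 0 < C → ∀ ε : ℝ, 0 < ε → ε < ε₀ →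
        ∀ p : ℕ → unitInterval, (∀ n, 0 < (p n : ℝ) ∧ (p n : ℝ) < 1) →
          Filter.Tendsto (fun n : ℕ => (n : ℝ) * (p n : ℝ) ^ ((Δ : ℝ) / 2))
            Filter.atTop Filter.atTop →
          (∀ᶠ n : ℕ in Filter.atTop,
            (n : ℝ) * (p n : ℝ) ^ ((Δ : ℝ) / 2) ≤ (n : ℝ) ^ ((1 : ℝ) / 2)) →
          (((1 / 2 : ℝ) * δ ^ ((2 : ℝ) / (Fintype.card V : ℝ)) * (1 - f ε) : ℝ) : EReal) ≤
            Filter.liminf (fun n : ℕ =>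
              -ENNReal.log (strongCoreProb H Δ δ ε C n (p n)) /
                (((n : ℝ) ^ 2 * (p n : ℝ) ^ Δ * Real.log (1 / (p n : ℝ)) : ℝ) : EReal))
              Filter.atTop := by
  classical
  -- Of the 8ε, six come from the definition, one from the negligible copies and one from the
  -- entropy of the union bound. The threshold 1/7 keeps 1 − 7ε positive.
  refine ⟨fun ε => 8 * |ε|, fun ε => by positivity, ?_, 1 / 7, by norm_num, ?_⟩
  · have h : Continuous fun ε : ℝ => 8 * |ε| := by fun_prop
    simpa using (h.tendsto 0).mono_left nhdsWithin_le_nhds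
  intro δ hδ C hC ε hε hε7 p hp hx hxn
  have hΔr : (0 : ℝ) < Δ := by exact_mod_cast (by omega : 0 < Δ)
  obtain ⟨x₀, A, hmain⟩ := exists_strongCoreProb_le H hΔ
    (fun a => by convert hreg.degree_eq a) hconn hδ hε hε7 hC
  -- This is the logarithm of n p^{Δ/2} ≤ n^{1/2}. It prices the choice of high vertices and also
  -- forces p → 0.
  have hlogn : ∀ᶠ n : ℕ in Filter.atTop, Real.log n ≤ Δ * Real.log (1 / (p n : ℝ)) := by
    filter_upwards [hxn, Filter.eventually_gt_atTop 0] with n hn hn0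
    have hnr : (0 : ℝ) < n := by exact_mod_cast hn0
    have hp0 := (hp n).1
    have h := Real.log_le_log (by positivity) hn
    rw [Real.log_mul hnr.ne' (by positivity), Real.log_rpow hp0, Real.log_rpow hnr] at h
    rw [one_div, Real.log_inv]
    linarith
  have hA : ∀ᶠ n : ℕ in Filter.atTop, A ≤ Real.log (1 / (p n : ℝ)) := by
    have h := (Real.tendsto_log_atTop.comp tendsto_natCast_atTop_atTop).eventually_ge_atTop
      ((Δ : ℝ) * A)
    filter_upwards [h, hlogn] with n h1 h2
    exact le_of_mul_le_mul_left (h1.trans h2) hΔr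
  refine Filter.le_liminf_of_le (by isBoundedDefault) ?_
  filter_upwards [hlogn, hA, hx.eventually_ge_atTop x₀, hx.eventually_ge_atTop 1,
    Filter.eventually_gt_atTop 0] with n h1 h2 h3 h4 h5
  have hp0 := (hp n).1
  have hlp : 0 < Real.log (1 / (p n : ℝ)) :=
    Real.log_pos (by rw [lt_div_iff₀ hp0]; linarith [(hp n).2])
  have hnr : (0 : ℝ) < n := by exact_mod_cast h5
  have hden : (0 : ℝ) < (n : ℝ) ^ 2 * (p n : ℝ) ^ Δ * Real.log (1 / (p n : ℝ)) := by positivity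
  have hprob := hmain n (p n) h5 hp0 (hp n).2 h3 h4 h2 h1
  -- Moving the negation across lets monotonicity of `ENNReal.log` conclude, with no separate case
  -- for probability zero.
  rw [EReal.le_div_iff_mul_le (by exact_mod_cast hden) (EReal.coe_ne_top _), abs_of_pos hε,
    ← EReal.coe_mul, EReal.le_neg, ← EReal.coe_neg]
  refine (ENNReal.log_monotone hprob).trans (le_of_eq ?_)
  rw [ENNReal.log_ofReal_of_pos (Real.exp_pos _), Real.log_exp]
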